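/- Let $\mathcal H$ be a separable infinite-dimensional complex Hilbert space and let $U(\mathcal H)$ be its unitary group with the strong operator topology. Let $G$ be a compact Lie group and let $\mathrm{Irrep}(G)$ be the set of isomorphism classes of (continuous, finite-dimensional, complex) irreducible representations of $G$. For a continuous homomorphism $\alpha : G \to U(\mathcal H)$ and $V \in \mathrm{Irrep}(G)$, let $\mathcal H_\alpha^V \subseteq \mathcal H$ be the $V$-isotypical component of the representation $\alpha$, i.e. the image of the evaluation map $V \otimes \hom_G(V,\mathcal H_\alpha) \to \mathcal H_\alpha$, where $\mathcal H_\alpha$ is $\mathcal H$ with the action of $G$ through $\alpha$. For $\mathcal C \subseteq \mathrm{Irrep}(G)$ let $\hom_{st}(G,U(\mathcal H))_{\mathcal C}$ be the set of continuous homomorphisms $\alpha : G \to U(\mathcal H)$ such that $\dim \mathcal H_\alpha^V = \infty$ for all $V \in \mathcal C$ and $\mathcal H_\alpha^V = 0$ for all $V \notin \mathcal C$, with the compact-open topology. Theorem. Suppose that $\mathcal C$ contains the trivial representation and at least one nontrivial irreducible representation. Then for every $\alpha \in \hom_{st}(G,U(\mathcal H))_{\mathcal C}$ the conjugation map $$\pi_\alpha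 : U(\mathcal H) \to \hom_{st}(G,U(\mathcal H))_{\mathcal C}, \qquad F \mapsto F\alpha F^{-1},$$ has no continuous section: there is no continuous map $\sigma : \hom_{st}(G,U(\mathcal H))_{\mathcal C} \to U(\mathcal H)$ with $\pi_\alpha \circ \sigma = \mathrm{id}$. -/

import Mathlib

open scoped ContDiff Manifold

noncomputable section

namespace StableHom

universe u v

/-! ### The unitary group with the strong operator topology -/

section UnitaryGroup

variable (H : Type v) [NormedAddCommGroup H] [InnerProductSpace ℂ H] [CompleteSpace H]

/-- The group `U(H)` of unitary operators of a complex Hilbert space `H`, as a type of its own, so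
that it does not inherit the norm topology of the space of bounded operators. -/
def UH : Type v := unitary (H →L[ℂ] H)

instance : Group (UH H) := inferInstanceAs (Group (unitary (H →L[ℂ] H)))

variable {H}

/-- The bounded operator underlying an element of `U(H)`. -/
def UH.op (F : UH H) : H →L[ℂ] H := Subtype.val (p := fun T => T ∈ unitary (H →L[ℂ] H)) F

theorem UH.op_one : (1 : UH H).op = 1 := rfl

theorem UH.op_mul (F F' : UH H) : (F * F').op = F.op * F'.op := rfl

/-- The strong operator topology: the topology of pointwise convergence on `H`. -/
instance : TopologicalSpace (UH H) :=
  TopologicalSpace.induced (fun (F : UH H) (x : H) => F.op x) inferInstance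

theorem UH.continuous_iff {X : Type*} [TopologicalSpace X] {f : X → UH H} :
    Continuous f ↔ ∀ x : H, Continuous fun t => (f t).op x := by
  rw [continuous_induced_rng, continuous_pi_iff]
  rfl

theorem UH.op_inv_op (F : UH H) (x : H) : F⁻¹.op (F.op x) = x := by
  have h : (F⁻¹ * F).op x = x := by rw [inv_mul_cancel]; rfl
  exact h

theorem UH.op_op_inv (F : UH H) (x : H) : F.op (F⁻¹.op x) = x := by
  have h : (F * F⁻¹).op x = x := by rw [mul_inv_cancel]; rfl
  exact h

end UnitaryGroup

/-! ### Isomorphism classes of irreducible representations -/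

section Irreps

variable (G : Type u) [Group G] [TopologicalSpace G]

/-- A continuous irreducible complex representation of `G` on a finite dimensional space, in
coordinates: the space is `ℂ^dim`. -/
structure IrrepObj where
  dim : ℕ
  rep : Representation ℂ G (Fin dim → ℂ)
  continuous_rep : ∀ w : Fin dim → ℂ, Continuous fun g => rep g w
  irreducible : rep.IsIrreducible

/-- Isomorphism of representations. -/
instance IrrepObj.setoid : Setoid (IrrepObj G) where
  r V W := Nonempty (V.rep.Equiv W.rep)
  iseqv :=
    { refl := fun V => ⟨Representation.Equiv.refl V.rep⟩
      symm := fun ⟨e⟩ => ⟨e.symm⟩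
      trans := fun ⟨e⟩ ⟨f⟩ => ⟨e.trans f⟩ }

/-- `Irrep(G)`: the isomorphism classes of irreducible representations. -/
def Irrep : Type u := Quotient (IrrepObj.setoid G)

variable {G}

/-- The isomorphism class of an irreducible representation. -/
def IrrepObj.cls (V : IrrepObj G) : Irrep G := Quotient.mk (IrrepObj.setoid G) V

variable (G)

/-- The trivial representation of `G` on `ℂ`. -/
def trivialObj : IrrepObj G where
  dim := 1
  rep := Representation.trivial ℂ G (Fin 1 → ℂ)
  continuous_rep w := continuous_const
  irreducible := by
    have hs : IsSimpleOrder (Submodule ℂ (Fin 1 → ℂ)) :=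
      is_simple_module_of_finrank_eq_one (K := ℂ) (by simp)
    refine { exists_pair_ne := ⟨⊥, ⊤, fun h => ?_⟩, eq_bot_or_eq_top := fun S => ?_ }
    · exact bot_ne_top (α := Submodule ℂ (Fin 1 → ℂ))
        (congrArg Subrepresentation.toSubmodule h)
    · rcases eq_bot_or_eq_top S.toSubmodule with h | h
      · exact Or.inl (Subrepresentation.toSubmodule_injective h)
      · exact Or.inr (Subrepresentation.toSubmodule_injective h)

/-- The class of the trivial representation. -/
def trivialIrrep : Irrep G := (trivialObj G).cls

end Irreps

/-! ### Stable homomorphisms and the conjugation map -/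

section Stable

variable {G : Type u} [Group G] [TopologicalSpace G]
variable {H : Type v} [NormedAddCommGroup H] [InnerProductSpace ℂ H] [CompleteSpace H]

/-- The representation `H_α` of `G` on `H` induced by a continuous homomorphism `α : G → U(H)`. -/
def repOf (α : G →ₜ* UH H) : Representation ℂ G H where
  toFun g := ((α g).op : H →ₗ[ℂ] H)
  map_one' := by rw [map_one, UH.op_one]; rfl
  map_mul' g g' := by rw [map_mul, UH.op_mul]; rfl

/-- The isotypical component `H_α^V`: the span of all vectors `f v` with `v ∈ V` and
`f ∈ hom_G(V, H_α)`, that is, the image of the evaluation map `V ⊗ hom_G(V, H_α) → H_α`. -/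
def isotypical (α : G →ₜ* UH H) (V : IrrepObj G) : Submodule ℂ H :=
  ⨆ f : V.rep.IntertwiningMap (repOf α), LinearMap.range f.toLinearMap

/-- `hom_st(G, U(H))_C`: the continuous homomorphisms `α : G → U(H)` such that `H_α^V` is infinite
dimensional for each `V ∈ C` and zero for each irreducible `V ∉ C`. As a type of elements of
`G →ₜ* UH H` it carries the subspace topology of the compact-open topology. -/
def homSt (G : Type u) [Group G] [TopologicalSpace G]
    (H : Type v) [NormedAddCommGroup H] [InnerProductSpace ℂ H] [CompleteSpace H]
    (C : Set (Irrep G)) : Set (G →ₜ* UH H) :=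
  {α | ∀ V : IrrepObj G,
    (V.cls ∈ C → ¬ FiniteDimensional ℂ (isotypical α V)) ∧
    (V.cls ∉ C → isotypical α V = ⊥)}

/-- The homomorphism `F α F⁻¹ : g ↦ F α(g) F⁻¹`. -/
def conj (F : UH H) (α : G →ₜ* UH H) : G →ₜ* UH H where
  toFun g := F * α g * F⁻¹
  map_one' := by simp
  map_mul' g g' := by simp [mul_assoc]
  continuous_toFun := by
    refine UH.continuous_iff.2 fun x => ?_
    exact F.op.continuous.comp (UH.continuous_iff.1 α.continuous_toFun (F⁻¹.op x))

theorem conj_apply (F : UH H) (α : G →ₜ* UH H) (g : G) : conj F α g = F * α g * F⁻¹ := rfl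

theorem conj_one (α : G →ₜ* UH H) : conj 1 α = α := by
  ext g; simp [conj_apply]

theorem conj_mul (F F' : UH H) (α : G →ₜ* UH H) : conj (F * F') α = conj F (conj F' α) := by
  ext g; simp [conj_apply, mul_assoc]

theorem map_isotypical_le (F : UH H) (α : G →ₜ* UH H) (V : IrrepObj G) :
    (isotypical α V).map (F.op : H →ₗ[ℂ] H) ≤ isotypical (conj F α) V := by
  rw [isotypical, Submodule.map_iSup]
  refine iSup_le fun f => ?_
  have hf : ∀ (g : G) (w : Fin V.dim → ℂ), f (V.rep g w) = (α g).op (f w) := fun g w =>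
    LinearMap.congr_fun (f.isIntertwining' g) w
  let f' : V.rep.IntertwiningMap (repOf (conj F α)) :=
    { toLinearMap := (F.op : H →ₗ[ℂ] H) ∘ₗ f.toLinearMap
      isIntertwining' := fun g => LinearMap.ext fun w => by
        change F.op (f (V.rep g w)) = F.op ((α g).op (F⁻¹.op (F.op (f w))))
        rw [hf, UH.op_inv_op] }
  refine le_trans ?_ (le_iSup (fun f : V.rep.IntertwiningMap (repOf (conj F α)) =>
    LinearMap.range f.toLinearMap) f')
  rintro _ ⟨_, ⟨w, rfl⟩, rfl⟩
  exact ⟨w, rfl⟩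

theorem isotypical_conj (F : UH H) (α : G →ₜ* UH H) (V : IrrepObj G) :
    isotypical (conj F α) V = (isotypical α V).map (F.op : H →ₗ[ℂ] H) := by
  refine le_antisymm (fun x hx => ?_) (map_isotypical_le F α V)
  have h := map_isotypical_le F⁻¹ (conj F α) V (Submodule.mem_map_of_mem hx)
  rw [← conj_mul, inv_mul_cancel, conj_one] at h
  exact ⟨_, h, UH.op_op_inv F x⟩

theorem conj_mem_homSt {C : Set (Irrep G)} (F : UH H) {α : G →ₜ* UH H} (hα : α ∈ homSt G H C) :
    conj F α ∈ homSt G H C := by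
  intro V
  have inj : Function.Injective (F.op : H →ₗ[ℂ] H) := fun x y h => by
    have h' : F.op x = F.op y := h
    rw [← UH.op_inv_op F x, h', UH.op_inv_op]
  rw [isotypical_conj]
  refine ⟨fun hV hfin => (hα V).1 hV ?_, fun hV => ?_⟩
  · exact (Submodule.equivMapOfInjective _ inj (isotypical α V)).symm.finiteDimensional
  · rw [(hα V).2 hV, Submodule.map_bot]

/-- The conjugation map `π_α : U(H) → hom_st(G, U(H))_C`, `F ↦ F α F⁻¹`. -/
def conjMap {C : Set (Irrep G)} (α : homSt G H C) (F : UH H) : homSt G H C :=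
  ⟨conj F α.1, conj_mem_homSt F α.2⟩

end Stable

end StableHom

end

/-! A section would trivialise too much: it would give every field of closed subspaces `S x` of a
separable Hilbert space `K`, with strongly continuous projections and all `S x`, `(S x)ᗮ`
infinite-dimensional, a nowhere vanishing continuous section (`exists_section_of_rightInverse`).
Over an infinite-dimensional compact base, a field of Dixmier–Douady type has no such section.

From `σ` to a section of the field: let `V` be a nontrivial class in `C`. Fix `x₀` and isometries `B
i : K → H` with pairwise orthogonal ranges, one for each vector of a frame of `V`, such that `S x₀`
plays the role of a multiplicity space of `V` and `(S x₀)ᗮ` is sent to fixed vectors. Choose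
unitaries `U x` of `K` carrying `S x₀` to `S x`, with no continuity in `x`, and let `F x` act as `U
x` on the range of each `B i`. The conjugate of `α` by `F x` depends only on the projection to `S
x`, so it varies continuously. With `s = σ (conjMap α (F x))`, the operator `(F x)⁻¹ * s` commutes
with `α`; hence `s` sends a fixed frame vector of `V` to `B i₀ a` with `a ∈ S x` nonzero, and `a` is
continuous in `x`.

The field without sections: for `x` in the unit ball of `ℂ²`, take the complement of the unit vector
`(x, √(1 - ‖x‖²) η)` in `ℂ² ⊕ ℂ η`, where the unit vector `η` tends weakly to `0` as `‖x‖` tends to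
`1`. The `ℂ²`-component is injective on this complement, and is orthogonal to `x` when `‖x‖ = 1`.
Over a countable product of balls, the Hilbert sum of these blocks is infinite-dimensional, and a
section of it yields functions `y n` with `y n x` orthogonal to `x n` whenever `‖x n‖ = 1`.
Brouwer's theorem with compactness of the product gives a common zero of all `y n`, where the
section vanishes. -/

noncomputable section

open MeasureTheory Metric Set Filter Topology TopologicalSpace

/-! ### Brouwer's fixed point theorem and common zeros on products of balls -/

section Brouwer

variable {E : Type*} [NormedAddCommGroup E] [InnerProductSpace ℝ E] [FiniteDimensional ℝ E]

/-- The determinant of `1 + τ A` is a polynomial in `τ` of degree at most `dim E`, so Lagrange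
interpolation recovers its value at `1` from small nodes. The weights do not depend on `A`, so the
identity can be integrated over a family of operators. -/
theorem exists_det_one_add_smul_interpolation (E : Type*) [NormedAddCommGroup E]
    [NormedSpace ℝ E] [FiniteDimensional ℝ E] {ε : ℝ} (hε : 0 < ε) :
    ∃ (s : Finset ℕ) (t c : ℕ → ℝ), (∀ i ∈ s, 0 < t i ∧ t i < ε) ∧
      ∀ A : E →L[ℝ] E, (1 + A).det = ∑ i ∈ s, c i * (1 + t i • A).det := by
  let n := Module.finrank ℝ E
  let s := Finset.range (n + 1)
  -- The shift by 2 keeps even the first node strictly below `ε`.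
  let t : ℕ → ℝ := fun i => ε / (i + 2)
  have hinj : Set.InjOn t s := by
    intro i _ j _ h
    have h1 : (i : ℝ) + 2 ≠ 0 := by positivity
    have h2 : (j : ℝ) + 2 ≠ 0 := by positivity
    simp only [t] at h
    rw [div_eq_div_iff h1 h2] at h
    have := mul_left_cancel₀ hε.ne' h
    exact_mod_cast (add_right_cancel this).symm
  refine ⟨s, t, fun i => (Lagrange.basis s t i).eval 1, fun i _ => ⟨by positivity, ?_⟩, ?_⟩
  · apply div_lt_self hε
    have : (0 : ℝ) ≤ i := by positivity
    linarith
  intro A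
  let b := Module.finBasis ℝ E
  let M := LinearMap.toMatrix b b (A : E →ₗ[ℝ] E)
  let p : Polynomial ℝ := Matrix.det ((Polynomial.X : Polynomial ℝ) • M.map Polynomial.C +
    (1 : Matrix (Fin n) (Fin n) ℝ).map Polynomial.C)
  have hp : ∀ x : ℝ, (1 + x • A).det = p.eval x := by
    intro x
    have h1 : LinearMap.toMatrix b b ((1 + x • A : E →L[ℝ] E) : E →ₗ[ℝ] E) = 1 + x • M := by
      have : ((1 + x • A : E →L[ℝ] E) : E →ₗ[ℝ] E) = 1 + x • (A : E →ₗ[ℝ] E) := rfl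
      rw [this, map_add, map_smul, LinearMap.toMatrix_one]
    rw [ContinuousLinearMap.det, ← LinearMap.det_toMatrix b, h1]
    change _ = Polynomial.evalRingHom x p
    rw [RingHom.map_det]
    congr 1
    ext i j
    simp only [Matrix.add_apply, Matrix.smul_apply, RingHom.mapMatrix_apply, Matrix.map_apply,
      Matrix.one_apply, smul_eq_mul, map_add, Polynomial.coe_evalRingHom,
      Polynomial.eval_C]
    rw [Polynomial.eval_mul, Polynomial.eval_X, Polynomial.eval_C]
    ring
  have hdeg : p.degree < s.card := by
    refine lt_of_le_of_lt Polynomial.degree_le_natDegree ?_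
    have := Polynomial.natDegree_det_X_add_C_le M (1 : Matrix (Fin n) (Fin n) ℝ)
    simp only [Fintype.card_fin] at this
    simp only [s, Finset.card_range]
    exact_mod_cast Nat.lt_succ_of_le this
  have h1 := hp 1
  rw [one_smul] at h1
  rw [h1, Lagrange.eq_interpolate hinj hdeg, Lagrange.interpolate_apply, Polynomial.eval_finsetSum]
  refine Finset.sum_congr rfl fun i _ => ?_
  rw [Polynomial.eval_mul, Polynomial.eval_C, hp, mul_comm]

theorem det_one_add_pos {A : E →L[ℝ] E} (hA : ‖A‖ < 1) : 0 < (1 + A).det := by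
  have hne : ∀ s ∈ Icc (0 : ℝ) 1, (1 + s • A).det ≠ 0 := by
    intro s hs h0
    have hlt : ‖-(s • A)‖ < 1 := by
      rw [norm_neg, norm_smul, Real.norm_of_nonneg hs.1]
      nlinarith [norm_nonneg A, hs.2]
    have hu := isUnit_one_sub_of_norm_lt_one hlt
    rw [sub_neg_eq_add] at hu
    have hu' : IsUnit ((1 + s • A : E →L[ℝ] E) : E →ₗ[ℝ] E) :=
      hu.map (ContinuousLinearMap.toLinearMapRingHom (R₁ := ℝ) (M₁ := E))
    exact (LinearMap.isUnit_det _ hu').ne_zero h0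
  by_contra hneg
  have hc : ContinuousOn (fun s : ℝ => (1 + s • A).det) (Icc 0 1) := by
    apply Continuous.continuousOn
    exact ContinuousLinearMap.continuous_det.comp (by fun_prop)
  have := intermediate_value_Icc' (zero_le_one) hc
  obtain ⟨s, hs, h⟩ := this (show (0 : ℝ) ∈ _ by
    refine ⟨by simpa using not_lt.1 hneg, ?_⟩
    simp [ContinuousLinearMap.det])
  exact hne s hs h

/-- The map is a convex combination of `x` and `h x + x`, so it preserves the open ball; being a
small Lipschitz perturbation of the identity, it is injective and open. Since it fixes the sphere,
its image is also relatively closed in the ball, and connectedness gives surjectivity. -/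
theorem image_ball_of_lipschitz_perturbation {h : E → E} {t : ℝ} {L : NNReal}
    (hL : LipschitzOnWith L h (closedBall 0 1)) (ht0 : 0 < t) (ht1 : t < 1) (htL : t * L < 1)
    (hs : ∀ x ∈ sphere (0 : E) 1, h x = 0)
    (hn : ∀ x ∈ closedBall (0 : E) 1, ‖h x + x‖ ≤ 1) :
    InjOn (fun x => x + t • h x) (ball 0 1) ∧
      (fun x => x + t • h x) '' ball 0 1 = ball (0 : E) 1 := by
  set g : E → E := fun x => x + t • h x with hg
  have hgn : ∀ x ∈ ball (0 : E) 1, g x ∈ ball (0 : E) 1 := by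
    intro x hx
    have h1 : g x = (1 - t) • x + t • (h x + x) := by simp only [hg]; module
    rw [mem_ball_zero_iff] at hx ⊢
    have h2 := hn x (by rw [mem_closedBall_zero_iff]; exact hx.le)
    calc ‖g x‖ ≤ ‖(1 - t) • x‖ + ‖t • (h x + x)‖ := by rw [h1]; exact norm_add_le _ _
      _ = (1 - t) * ‖x‖ + t * ‖h x + x‖ := by
        rw [norm_smul, norm_smul, Real.norm_of_nonneg ht0.le, Real.norm_of_nonneg (by linarith)]
      _ < 1 := by nlinarith
  let c : NNReal := t.toNNReal * L
  have hc : c < 1 := by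
    rw [← NNReal.coe_lt_coe, NNReal.coe_mul, Real.coe_toNNReal _ ht0.le]
    exact htL
  have happ : ApproximatesLinearOn g ((ContinuousLinearEquiv.refl ℝ E : E ≃L[ℝ] E) : E →L[ℝ] E)
      (ball 0 1) c := by
    intro x hx y hy
    have h1 : g x - g y - ((ContinuousLinearEquiv.refl ℝ E : E ≃L[ℝ] E) : E →L[ℝ] E) (x - y) =
        t • (h x - h y) := by
      simp only [hg, ContinuousLinearEquiv.coe_coe, ContinuousLinearEquiv.coe_refl', id]
      module
    rw [h1, norm_smul, Real.norm_of_nonneg ht0.le]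
    have h2 := hL.norm_sub_le (ball_subset_closedBall hx) (ball_subset_closedBall hy)
    calc t * ‖h x - h y‖ ≤ t * (L * ‖x - y‖) := by gcongr
      _ = c * ‖x - y‖ := by
        rw [NNReal.coe_mul, Real.coe_toNNReal _ ht0.le, mul_assoc]
  have hN : ‖(ContinuousLinearEquiv.refl ℝ E : E ≃L[ℝ] E).symm.toContinuousLinearMap‖₊ ≤ 1 :=
    ContinuousLinearMap.norm_id_le
  have hcN : Subsingleton E ∨
      c < ‖((ContinuousLinearEquiv.refl ℝ E : E ≃L[ℝ] E).symm : E →L[ℝ] E)‖₊⁻¹ := by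
    rcases subsingleton_or_nontrivial E with hE | hE
    · exact Or.inl hE
    · right
      refine lt_of_lt_of_le hc ?_
      rw [one_le_inv₀]
      · exact hN
      · exact (ContinuousLinearEquiv.refl ℝ E).nnnorm_symm_pos
  refine ⟨happ.injOn hcN, Subset.antisymm (image_subset_iff.2 hgn) ?_⟩
  have hopen : IsOpen (g '' ball 0 1) :=
    happ.open_image (ContinuousLinearEquiv.refl ℝ E).toNonlinearRightInverse isOpen_ball hcN
  have hcont : ContinuousOn g (closedBall 0 1) :=
    continuousOn_id.add (hL.continuousOn.const_smul t)
  have hcl : closure (g '' ball 0 1) ⊆ g '' closedBall 0 1 :=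
    closure_minimal (image_mono ball_subset_closedBall)
      ((isCompact_closedBall 0 1).image_of_continuousOn hcont).isClosed
  refine (convex_ball (0 : E) 1).isPreconnected.subset_of_closure_inter_subset hopen ?_ ?_
  · have h0 : (0 : E) ∈ ball (0 : E) 1 := mem_ball_self one_pos
    exact ⟨g 0, hgn 0 h0, mem_image_of_mem g h0⟩
  · rintro y ⟨hy, hyb⟩
    obtain ⟨x, hx, rfl⟩ := hcl hy
    rcases eq_or_lt_of_le (mem_closedBall.1 hx) with h1 | h1
    · exfalso
      have h2 : g x = x := by simp only [hg]; rw [hs x h1, smul_zero, add_zero]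
      rw [h2, mem_ball] at hyb
      exact hyb.ne h1
    · exact mem_image_of_mem g h1

/-- Volume argument: put `h = r - id`. For small `t` the map `id + t h` is a bijection of the ball,
so the integral of its Jacobian is the volume of the ball. By polynomial dependence on `t` the same
holds at `t = 1`, where the Jacobian of `r` vanishes because `r` takes values in the sphere. -/
theorem not_exists_contDiffOn_retraction_sphere {r : E → E} {U : Set E} (hU : IsOpen U)
    (hBU : closedBall 0 1 ⊆ U) (hr : ContDiffOn ℝ 1 r U)
    (hr1 : ∀ x ∈ closedBall (0 : E) 1, ‖r x‖ = 1) (hrs : ∀ x ∈ sphere (0 : E) 1, r x = x) :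
    False := by
  borelize E
  let h : E → E := fun x => r x - x
  have hh : ContDiffOn ℝ 1 h U := hr.sub contDiffOn_id
  have hd : ∀ x ∈ U, HasFDerivAt h (fderiv ℝ h x) x := fun x hx =>
    ((hh.differentiableOn one_ne_zero).differentiableAt (hU.mem_nhds hx)).hasFDerivAt
  have hcd : ContinuousOn (fderiv ℝ h) U := hh.continuousOn_fderiv_of_isOpen hU le_rfl
  obtain ⟨L0, hL0⟩ := (isCompact_closedBall (0 : E) 1).exists_bound_of_continuousOn
    (hcd.mono hBU)
  let L : NNReal := L0.toNNReal
  have hLb : ∀ x ∈ closedBall (0 : E) 1, ‖fderiv ℝ h x‖₊ ≤ L := fun x hx => by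
    rw [← NNReal.coe_le_coe, coe_nnnorm]
    exact (hL0 x hx).trans (Real.le_coe_toNNReal _)
  have hL : LipschitzOnWith L h (closedBall 0 1) :=
    (convex_closedBall (0 : E) 1).lipschitzOnWith_of_nnnorm_hasFDerivWithin_le
      (fun x hx => (hd x (hBU hx)).hasFDerivWithinAt) hLb
  have hLpos : (0 : ℝ) < L + 1 := by positivity
  obtain ⟨s, t, c, hst, hdet⟩ := exists_det_one_add_smul_interpolation E
    (ε := 1 / (L + 1)) (by positivity)
  have hsum : ∑ i ∈ s, c i = 1 := by
    have := hdet 0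
    simp only [add_zero, smul_zero] at this
    simpa [ContinuousLinearMap.det] using this.symm
  let μ : Measure E := Measure.addHaar
  have key : ∀ i ∈ s, ∫ x in ball (0 : E) 1, (1 + t i • fderiv ℝ h x).det ∂μ
      = μ.real (ball 0 1) := by
    intro i hi
    obtain ⟨hi0, hi1⟩ := hst i hi
    rw [lt_div_iff₀ hLpos] at hi1
    have hti1 : t i < 1 := by nlinarith [L.2, mul_nonneg hi0.le L.2]
    have htiL : t i * L < 1 := by nlinarith
    obtain ⟨hinj, himg⟩ := image_ball_of_lipschitz_perturbation hL hi0 hti1 htiL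
      (fun x hx => by simp only [h, hrs x hx, sub_self])
      (fun x hx => by simp only [h, sub_add_cancel]; exact (hr1 x hx).le)
    have hcv := integral_image_eq_integral_abs_det_fderiv_smul μ measurableSet_ball
      (f' := fun x => 1 + t i • fderiv ℝ h x)
      (fun x hx => ((hasFDerivAt_id x).add
        ((hd x (hBU (ball_subset_closedBall hx))).const_smul (t i))).hasFDerivWithinAt)
      hinj (fun _ => (1 : ℝ))
    have himg' : (id + t i • h) '' ball 0 1 = ball (0 : E) 1 := himg
    rw [himg'] at hcv
    simp only [smul_eq_mul, mul_one, integral_const, measureReal_restrict_apply_univ] at hcv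
    rw [hcv]
    refine setIntegral_congr_fun measurableSet_ball fun x hx => ?_
    refine (abs_of_pos (det_one_add_pos ?_)).symm
    rw [norm_smul, Real.norm_of_nonneg hi0.le]
    refine lt_of_le_of_lt ?_ htiL
    gcongr
    exact hLb x (ball_subset_closedBall hx)
  have hint : ∀ τ : ℝ, IntegrableOn (fun x => (1 + τ • fderiv ℝ h x).det) (ball (0 : E) 1) μ := by
    intro τ
    have hc : ContinuousOn (fun x => (1 + τ • fderiv ℝ h x).det) (closedBall (0 : E) 1) :=
      ContinuousLinearMap.continuous_det.comp_continuousOn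
        (continuousOn_const.add ((hcd.mono hBU).const_smul τ))
    exact (hc.integrableOn_compact (isCompact_closedBall 0 1)).mono_set ball_subset_closedBall
  have hzero : ∫ x in ball (0 : E) 1, (1 + fderiv ℝ h x).det ∂μ = 0 := by
    refine setIntegral_eq_zero_of_forall_eq_zero fun x hx => ?_
    by_contra hne
    have hxB := ball_subset_closedBall hx
    have hrd : HasFDerivAt r (1 + fderiv ℝ h x) x := by
      have := (hasFDerivAt_id x).add (hd x (hBU hxB))
      refine this.congr_of_eventuallyEq (Eventually.of_forall fun y => ?_)
      simp [h]
    -- If the derivative of `r` were onto, some `v` would be sent to `r x`; differentiating `‖r‖² =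
    -- 1` along `v` would give `2 = 0`.
    have hn : HasFDerivAt (fun y => inner ℝ (r y) (r y)) (0 : E →L[ℝ] ℝ) x := by
      refine (hasFDerivAt_const (1 : ℝ) x).congr_of_eventuallyEq ?_
      filter_upwards [isOpen_ball.mem_nhds hx] with y hy
      rw [real_inner_self_eq_norm_sq, hr1 y (ball_subset_closedBall hy), one_pow]
    have hn2 := hn.unique (hrd.inner ℝ hrd)
    have hu : IsUnit (((1 + fderiv ℝ h x : E →L[ℝ] E) : E →ₗ[ℝ] E)) :=
      (LinearMap.isUnit_iff_isUnit_det _).2 (isUnit_iff_ne_zero.2 hne)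
    obtain ⟨v, hv⟩ := ((Module.End.isUnit_iff _).1 hu).2 (r x)
    have h3 := congrArg (fun T : E →L[ℝ] ℝ => T v) hn2
    have hv' : (1 + fderiv ℝ h x : E →L[ℝ] E) v = r x := hv
    simp only [zero_apply, ContinuousLinearMap.comp_apply,
      ContinuousLinearMap.prod_apply, fderivInnerCLM_apply, hv', real_inner_self_eq_norm_sq,
      hr1 x hxB] at h3
    norm_num at h3
  have hfin : ∫ x in ball (0 : E) 1, (1 + fderiv ℝ h x).det ∂μ = μ.real (ball 0 1) := by
    rw [setIntegral_congr_fun measurableSet_ball fun x _ => hdet (fderiv ℝ h x)]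
    rw [integral_finsetSum _ fun i _ => (hint (t i)).const_mul (c i)]
    simp only [integral_const_mul]
    rw [Finset.sum_congr rfl fun i hi => by rw [key i hi], ← Finset.sum_mul, hsum, one_mul]
  have hpos : 0 < μ.real (ball (0 : E) 1) :=
    ENNReal.toReal_pos (measure_ball_pos μ 0 one_pos).ne' measure_ball_lt_top.ne
  rw [hzero] at hfin
  exact hpos.ne hfin

/-- Without fixed points, `‖g x - x‖` has a positive minimum `δ` on the ball. A smooth `p` within
`δ` of `g` then has no fixed point there either, and the ray from `p x` through `x` meets the sphere
in a smooth retraction. -/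
theorem exists_fixedPoint_of_norm_le_one {g : E → E} (hg : Continuous g) (hg1 : ∀ x, ‖g x‖ ≤ 1) :
    ∃ x, g x = x := by
  by_contra! hne
  obtain ⟨x₀, -, hx₀⟩ := (isCompact_closedBall (0 : E) 1).exists_isMinOn
    ⟨0, mem_closedBall_self zero_le_one⟩ (f := fun x => ‖g x - x‖) (by fun_prop)
  have hδ : 0 < ‖g x₀ - x₀‖ := norm_pos_iff.2 (sub_ne_zero.2 (hne x₀))
  set δ := ‖g x₀ - x₀‖
  obtain ⟨p, hp⟩ := exists_contMDiffMap_forall_mem_convex_of_local_const (n := 1) 𝓘(ℝ, E)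
    (t := fun x => ball (g x) δ ∩ closedBall (0 : E) 1)
    (fun x => (convex_ball _ _).inter (convex_closedBall _ _))
    (fun x => ⟨g x, by
      have : ∀ᶠ y in 𝓝 x, dist (g x) (g y) < δ := by
        have h1 : Tendsto (fun y => dist (g x) (g y)) (𝓝 x) (𝓝 (dist (g x) (g x))) :=
          (continuous_const.dist hg).tendsto x
        rw [dist_self] at h1
        exact h1.eventually (gt_mem_nhds hδ)
      filter_upwards [this] with y hy
      exact ⟨hy, mem_closedBall_zero_iff.2 (hg1 x)⟩⟩)
  have hpc : ContDiff ℝ 1 p := p.contMDiff.contDiff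
  have hp1 : ∀ x, ‖p x‖ ≤ 1 := fun x => mem_closedBall_zero_iff.1 (hp x).2
  have hpx : ∀ x ∈ closedBall (0 : E) 1, x - p x ≠ 0 := by
    intro x hx h0
    have h1 : δ ≤ ‖g x - x‖ := hx₀ hx
    have h2 : dist (p x) (g x) < δ := (hp x).1
    rw [← sub_eq_zero.1 h0, dist_comm, dist_eq_norm] at h2
    exact absurd h2 (not_lt.2 h1)
  let u : E → E := fun x => x - p x
  -- `D` is a quarter of the discriminant of the quadratic equation `‖x + λ u‖² = 1` in `λ`, and `l`
  -- is its larger root. Positivity of `D` makes the square root smooth.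
  let D : E → ℝ := fun x => inner ℝ x (u x) ^ 2 + ‖u x‖ ^ 2 * (1 - ‖x‖ ^ 2)
  let l : E → ℝ := fun x => (-inner ℝ x (u x) + √(D x)) / ‖u x‖ ^ 2
  let U : Set E := {x | u x ≠ 0} ∩ {x | 0 < D x}
  have huc : ContDiff ℝ 1 u := contDiff_id.sub hpc
  have hDc : ContDiff ℝ 1 D := ((contDiff_id.inner ℝ huc).pow 2).add
    ((huc.norm_sq ℝ).mul (contDiff_const.sub (contDiff_id.norm_sq ℝ)))
  have hU : IsOpen U := (isOpen_ne_fun huc.continuous continuous_const).inter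
    (isOpen_lt continuous_const hDc.continuous)
  have hsph : ∀ x ∈ sphere (0 : E) 1, 0 < inner ℝ x (u x) := by
    intro x hx
    have hx1 : ‖x‖ = 1 := mem_sphere_zero_iff_norm.1 hx
    have h1 : 0 < ‖x - p x‖ ^ 2 := by
      have := norm_pos_iff.2 (hpx x (sphere_subset_closedBall hx))
      positivity
    rw [norm_sub_sq_real, hx1] at h1
    have h2 : ‖p x‖ ^ 2 ≤ 1 := pow_le_one₀ (norm_nonneg _) (hp1 x)
    simp only [u, inner_sub_right, real_inner_self_eq_norm_sq, hx1]
    linarith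
  have hBU : closedBall 0 1 ⊆ U := by
    intro x hx
    refine ⟨hpx x hx, ?_⟩
    rcases eq_or_lt_of_le (mem_closedBall_zero_iff.1 hx) with h1 | h1
    · have := hsph x (mem_sphere_zero_iff_norm.2 h1)
      simp only [mem_ofPred_eq, D, h1]
      nlinarith
    · have h2 : 0 < ‖u x‖ := norm_pos_iff.2 (hpx x hx)
      have h3 : 0 < 1 - ‖x‖ ^ 2 := by nlinarith [norm_nonneg x]
      simp only [mem_ofPred_eq, D]
      positivity
  have hr : ContDiffOn ℝ 1 (fun x => x + l x • u x) U := by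
    refine contDiffOn_id.add (ContDiffOn.smul ?_ huc.contDiffOn)
    refine ContDiffOn.div ?_ (huc.norm_sq ℝ).contDiffOn fun x hx => ?_
    · exact (contDiff_id.inner ℝ huc).neg.contDiffOn.add
        (hDc.contDiffOn.sqrt fun x hx => hx.2.ne')
    · exact pow_ne_zero _ (norm_ne_zero_iff.2 hx.1)
  refine not_exists_contDiffOn_retraction_sphere hU hBU hr (fun x hx => ?_) fun x hx => ?_
  · have hu0 : ‖u x‖ ^ 2 ≠ 0 := pow_ne_zero _ (norm_ne_zero_iff.2 (hBU hx).1)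
    have hD : √(D x) ^ 2 = D x := Real.sq_sqrt (hBU hx).2.le
    have hl : l x * ‖u x‖ ^ 2 = -inner ℝ x (u x) + √(D x) := div_mul_cancel₀ _ hu0
    have h1 : ‖x + l x • u x‖ ^ 2 = 1 := by
      rw [norm_add_sq_real, inner_smul_right, norm_smul, mul_pow, Real.norm_eq_abs, sq_abs]
      refine mul_right_cancel₀ hu0 ?_
      have h2 : (l x * ‖u x‖ ^ 2 + inner ℝ x (u x)) ^ 2 = D x := by
        rw [hl, neg_add_cancel_comm, hD]
      simp only [D] at h2
      linear_combination h2
    rwa [pow_eq_one_iff_of_nonneg (norm_nonneg _) two_ne_zero] at h1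
  · have hx1 : ‖x‖ = 1 := mem_sphere_zero_iff_norm.1 hx
    have : l x = 0 := by
      simp only [l, D, hx1]
      norm_num
      rw [Real.sqrt_sq (hsph x hx).le]
      simp
    simp [this]

theorem exists_fixedPoint_of_isBounded_range {F : Type*} [NormedAddCommGroup F] [NormedSpace ℝ F]
    [FiniteDimensional ℝ F] {g : F → F} (hg : Continuous g)
    (hb : Bornology.IsBounded (Set.range g)) : ∃ x, g x = x := by
  let e : F ≃L[ℝ] EuclideanSpace ℝ (Fin (Module.finrank ℝ F)) := toEuclidean
  obtain ⟨R0, hR0⟩ := hb.exists_norm_le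
  let R : ℝ := ‖(e : F →L[ℝ] EuclideanSpace ℝ (Fin (Module.finrank ℝ F)))‖ * |R0| + 1
  have hR : 0 < R := by positivity
  obtain ⟨x, hx⟩ := exists_fixedPoint_of_norm_le_one
    (g := fun x => R⁻¹ • e (g (e.symm (R • x)))) (by fun_prop) (fun x => by
      rw [norm_smul, norm_inv, Real.norm_of_nonneg hR.le, inv_mul_le_one₀ hR]
      refine ((e : F →L[ℝ] EuclideanSpace ℝ (Fin (Module.finrank ℝ F))).le_opNorm _).trans ?_
      have : ‖g (e.symm (R • x))‖ ≤ |R0| := (hR0 _ (mem_range_self _)).trans (le_abs_self _)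
      simp only [R]
      nlinarith [norm_nonneg (e : F →L[ℝ] EuclideanSpace ℝ (Fin (Module.finrank ℝ F)))])
  refine ⟨e.symm (R • x), e.injective ?_⟩
  rw [e.apply_symm_apply]
  nth_rewrite 2 [← hx]
  rw [smul_inv_smul₀ hR.ne']

/-- The radial retraction onto the closed unit ball. -/
def radialRetraction {F : Type*} [NormedAddCommGroup F] [NormedSpace ℝ F] (x : F) : F :=
  (max 1 ‖x‖)⁻¹ • x

section Radial

variable {F : Type*} [NormedAddCommGroup F] [NormedSpace ℝ F]

theorem continuous_radialRetraction : Continuous (radialRetraction : F → F) :=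
  ((continuous_const.max continuous_norm).inv₀ fun x =>
    (lt_of_lt_of_le one_pos (le_max_left 1 ‖x‖)).ne').smul continuous_id

theorem norm_radialRetraction_le_one (x : F) : ‖radialRetraction x‖ ≤ 1 := by
  have h : 0 < max 1 ‖x‖ := lt_of_lt_of_le one_pos (le_max_left 1 ‖x‖)
  rw [radialRetraction, norm_smul, norm_inv, Real.norm_of_nonneg h.le, inv_mul_le_one₀ h]
  exact le_max_right _ _

theorem radialRetraction_eq_self {x : F} (hx : ‖x‖ ≤ 1) : radialRetraction x = x := by
  rw [radialRetraction, max_eq_left hx, inv_one, one_smul]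

theorem norm_radialRetraction_eq_one {x : F} (hx : 1 ≤ ‖x‖) : ‖radialRetraction x‖ = 1 := by
  rw [radialRetraction, max_eq_right hx, norm_smul, norm_inv, norm_norm,
    inv_mul_cancel₀ (by linarith)]

end Radial

/-- At a fixed point of `x n ↦ radialRetraction (x n + y n x)`, either the retraction does nothing
and `y n x = 0`, or `x n` is a unit vector and `x n + y n x` is a multiple of it by a factor greater
than 1. Orthogonality excludes the latter. -/
theorem exists_forall_eq_zero_of_inner_eq_zero {F : Type*} [NormedAddCommGroup F]
    [InnerProductSpace ℂ F] [FiniteDimensional ℂ F] {N : ℕ}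
    {y : Fin N → (ℕ → closedBall (0 : F) 1) → F} (hy : ∀ n, Continuous (y n))
    (hy0 : ∀ (n : Fin N) (x : ℕ → closedBall (0 : F) 1), ‖(x n : F)‖ = 1 →
      inner ℂ (x n : F) (y n x) = 0) :
    ∃ x, ∀ n, y n x = 0 := by
  have : FiniteDimensional ℝ F := FiniteDimensional.complexToReal F
  -- Coordinates from `N` on are set to 0, and the first `N` are retracted so that the fixed point
  -- theorem applies on a whole vector space.
  let ex : (Fin N → F) → (ℕ → closedBall (0 : F) 1) := fun v n =>
    if h : n < N then
      ⟨radialRetraction (v ⟨n, h⟩), mem_closedBall_zero_iff.2 (norm_radialRetraction_le_one _)⟩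
    else ⟨0, mem_closedBall_self zero_le_one⟩
  have hex : Continuous ex := by
    refine continuous_pi fun n => ?_
    by_cases h : n < N
    · simp only [ex, h, dif_pos]
      exact (continuous_radialRetraction.comp (continuous_apply _)).subtype_mk _
    · simp only [ex, h, dif_neg, not_false_eq_true]
      exact continuous_const
  have hex_val : ∀ v (n : Fin N), (ex v n : F) = radialRetraction (v n) := fun v n => by
    simp only [ex, n.2, dif_pos]
  obtain ⟨v, hv⟩ := exists_fixedPoint_of_isBounded_range
    (g := fun (v : Fin N → F) n => radialRetraction ((ex v n : F) + y n (ex v)))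
    (continuous_pi fun n => continuous_radialRetraction.comp
      ((continuous_subtype_val.comp ((continuous_apply _).comp hex)).add ((hy n).comp hex)))
    (by
      refine (isBounded_iff_forall_norm_le.2 ⟨1, ?_⟩)
      rintro _ ⟨v, rfl⟩
      exact (pi_norm_le_iff_of_nonneg zero_le_one).2 fun n => norm_radialRetraction_le_one _)
  refine ⟨ex v, fun n => ?_⟩
  have hvn : radialRetraction ((ex v n : F) + y n (ex v)) = v n := congrFun hv n
  have hv1 : ‖v n‖ ≤ 1 := hvn ▸ norm_radialRetraction_le_one _
  have hexv : (ex v n : F) = v n := by rw [hex_val, radialRetraction_eq_self hv1]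
  rw [hexv] at hvn
  rcases le_or_gt ‖v n + y n (ex v)‖ 1 with h | h
  · rwa [radialRetraction_eq_self h, add_eq_left] at hvn
  · have hn1 : ‖v n‖ = 1 := hvn ▸ norm_radialRetraction_eq_one h.le
    have hin := hy0 n (ex v) (by rw [hexv, hn1])
    rw [hexv] at hin
    have h1 : v n + y n (ex v) = ((‖v n + y n (ex v)‖ : ℝ) : ℂ) • v n := by
      have h5 := congrArg (fun z => ‖v n + y n (ex v)‖ • z) hvn
      simp only [radialRetraction, max_eq_right h.le] at h5
      rw [smul_inv_smul₀ (by linarith)] at h5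
      rw [Complex.coe_smul]
      exact h5
    have h2 := congrArg (inner ℂ (v n)) h1
    rw [inner_add_right, hin, inner_smul_right, inner_self_eq_norm_sq_to_K, hn1] at h2
    norm_num at h2
    have h3 : ‖v n + y n (ex v)‖ = 1 := by exact_mod_cast h2.symm
    linarith

/-- The common zero sets of the first `N` functions are closed, nested and nonempty in a compact
product. -/
theorem exists_forall_eq_zero_of_inner_eq_zero' {F : Type*} [NormedAddCommGroup F]
    [InnerProductSpace ℂ F] [FiniteDimensional ℂ F]
    {y : ℕ → (ℕ → closedBall (0 : F) 1) → F} (hy : ∀ n, Continuous (y n))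
    (hy0 : ∀ (n : ℕ) (x : ℕ → closedBall (0 : F) 1), ‖(x n : F)‖ = 1 →
      inner ℂ (x n : F) (y n x) = 0) :
    ∃ x, ∀ n, y n x = 0 := by
  have : ProperSpace F := FiniteDimensional.proper ℂ F
  have : CompactSpace (closedBall (0 : F) 1) :=
    isCompact_iff_compactSpace.1 (isCompact_closedBall 0 1)
  have hcl : ∀ N, IsClosed {x | ∀ n < N, y n x = 0} := fun N => by
    simp only [ofPred_forall]
    exact isClosed_iInter fun n => isClosed_iInter fun _ => isClosed_eq (hy n) continuous_const
  obtain ⟨x, hx⟩ := IsCompact.nonempty_iInter_of_sequence_nonempty_isCompact_isClosed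
    (fun N => {x | ∀ n < N, y n x = 0}) (fun N x hx n hn => hx n (hn.trans N.lt_succ_self))
    (fun N => by
      obtain ⟨x, hx⟩ := exists_forall_eq_zero_of_inner_eq_zero (N := N) (y := fun n => y n)
        (fun n => hy n) (fun n => hy0 n)
      exact ⟨x, fun n hn => hx ⟨n, hn⟩⟩)
    (hcl 0).isCompact hcl
  exact ⟨x, fun n => mem_iInter.1 hx (n + 1) n n.lt_succ_self⟩

end Brouwer

/-! ### Strong continuity of families of projections -/

section ContinuousFamilies

variable {X K : Type*} [TopologicalSpace X] [NormedAddCommGroup K]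

theorem continuous_apply_of_mem_closure_span [NormedSpace ℂ K] {K' : Type*} [NormedAddCommGroup K']
    [NormedSpace ℂ K'] {T : X → K →L[ℂ] K'} {C : ℝ} (hT : ∀ x, ‖T x‖ ≤ C) {D : Set K}
    (hD : ∀ d ∈ D, Continuous fun x => T x d) {v : K}
    (hv : v ∈ (Submodule.span ℂ D).topologicalClosure) : Continuous fun x => T x v := by
  have hspan : ∀ w ∈ Submodule.span ℂ D, Continuous fun x => T x w := by
    intro w hw
    induction hw using Submodule.span_induction with
    | mem d hd => exact hD d hd
    | zero => simpa using continuous_const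
    | add a b _ _ ha hb => simp only [map_add]; exact ha.add hb
    | smul c a _ ha => simp only [map_smul]; exact ha.const_smul c
  rw [← SetLike.mem_coe, Submodule.topologicalClosure_coe, Metric.mem_closure_iff] at hv
  refine continuous_of_uniform_approx_of_continuous fun U hU => ?_
  obtain ⟨ε, hε, hεU⟩ := Metric.mem_uniformity_dist.1 hU
  obtain ⟨w, hw, hvw⟩ := hv (ε / (|C| + 1)) (by positivity)
  refine ⟨fun x => T x w, hspan w hw, fun x => hεU ?_⟩
  rw [dist_eq_norm, ← map_sub]
  rw [dist_eq_norm, lt_div_iff₀ (by positivity)] at hvw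
  calc ‖T x (v - w)‖ ≤ C * ‖v - w‖ := (T x).le_of_opNorm_le (hT x) _
    _ ≤ ‖v - w‖ * (|C| + 1) := by nlinarith [le_abs_self C, norm_nonneg (v - w)]
    _ < ε := hvw

/-- For projections weak continuity implies strong continuity, since `‖P d‖²` is the matrix
coefficient of `P` at `d`. By uniform boundedness, a total set of vectors suffices to test weak
continuity. -/
theorem continuous_starProjection_of_inner [InnerProductSpace ℂ K] {S : X → Submodule ℂ K}
    [∀ x, (S x).HasOrthogonalProjection] {D : Set K}
    (hD : (Submodule.span ℂ D).topologicalClosure = ⊤)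
    (hS : ∀ d ∈ D, ∀ d' ∈ D, Continuous fun x => inner ℂ d ((S x).starProjection d')) (v : K) :
    Continuous fun x => (S x).starProjection v := by
  refine continuous_apply_of_mem_closure_span (C := 1) (D := D)
    (fun x => Submodule.starProjection_norm_le _) (fun d hd => ?_) (hD ▸ Submodule.mem_top)
  have hweak : ∀ w, Continuous fun x => inner ℂ w ((S x).starProjection d) := by
    intro w
    have h1 : Continuous fun x => innerSL ℂ ((S x).starProjection d) w := by
      refine continuous_apply_of_mem_closure_span (C := ‖d‖) (D := D) (fun x => ?_)
        (fun d' hd' => ?_) (hD ▸ Submodule.mem_top)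
      · rw [innerSL_apply_norm]
        exact (Submodule.norm_starProjection_apply_le _ _)
      · have h2 := (hS d' hd' d hd).star
        simpa only [innerSL_apply_apply, RCLike.star_def, inner_conj_symm] using h2
    have h2 := h1.star
    simpa only [innerSL_apply_apply, RCLike.star_def, inner_conj_symm] using h2
  rw [continuous_iff_continuousAt]
  intro x₀
  rw [ContinuousAt, tendsto_iff_norm_sub_tendsto_zero]
  have hsq : Tendsto (fun x => ‖(S x).starProjection d - (S x₀).starProjection d‖ ^ 2) (𝓝 x₀)
      (𝓝 0) := by
    have heq : ∀ x, ‖(S x).starProjection d - (S x₀).starProjection d‖ ^ 2 =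
        RCLike.re (inner ℂ d ((S x).starProjection d)) -
          2 * RCLike.re (inner ℂ ((S x₀).starProjection d) ((S x).starProjection d)) +
          ‖(S x₀).starProjection d‖ ^ 2 := by
      intro x
      rw [@norm_sub_sq ℂ, inner_re_symm ((S x).starProjection d)]
      congr 2
      rw [← inner_self_eq_norm_sq (𝕜 := ℂ), Submodule.inner_starProjection_left_eq_right]
      congr 2
      exact Submodule.starProjection_eq_self_iff.2 (Submodule.starProjection_apply_mem _ _)
    simp only [heq]
    have hc : Continuous fun x => RCLike.re (inner ℂ d ((S x).starProjection d)) -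
          2 * RCLike.re (inner ℂ ((S x₀).starProjection d) ((S x).starProjection d)) +
          ‖(S x₀).starProjection d‖ ^ 2 :=
      ((RCLike.continuous_re.comp (hweak d)).sub
        (continuous_const.mul (RCLike.continuous_re.comp (hweak _)))).add continuous_const
    have := hc.tendsto x₀
    rw [← heq x₀] at this
    simpa using this
  have := hsq.sqrt
  simpa [Real.sqrt_sq (norm_nonneg _)] using this

end ContinuousFamilies

/-! ### A path of unit vectors tending weakly to zero -/

section EscapingVector

/-- A path of unit vectors of `ℓ²`, `r ↦ √(1 - r²) (1, r, r², …)`, that escapes weakly to `0` as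
`r` tends to `1`. -/
def escapingVector (r : ℝ) : lp (fun _ : ℕ => ℂ) 2 :=
  if h : r ∈ Ico (0 : ℝ) 1 then
    ⟨fun k => ((√(1 - r ^ 2) * r ^ k : ℝ) : ℂ), by
      refine memℓp_gen ?_
      have h1 : Summable fun k : ℕ => (1 - r ^ 2) * (r ^ 2) ^ k :=
        (summable_geometric_of_lt_one (sq_nonneg r) (by nlinarith [h.1, h.2])).mul_left _
      refine h1.congr fun k => ?_
      have h2 : 0 ≤ 1 - r ^ 2 := by nlinarith [h.1, h.2]
      have h3 : 0 ≤ √(1 - r ^ 2) * r ^ k := mul_nonneg (Real.sqrt_nonneg _) (pow_nonneg h.1 k)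
      rw [Complex.norm_real, Real.norm_of_nonneg h3]
      simp only [ENNReal.toReal_ofNat, Real.rpow_ofNat]
      rw [mul_pow, Real.sq_sqrt h2]
      ring⟩
  else 0

theorem escapingVector_one : escapingVector 1 = 0 := dif_neg (by simp)

/-- At `r = 1` the factor `√(1 - r²)` vanishes, in agreement with the default value 0, so each
coordinate is continuous on the closed interval although the norm jumps. -/
theorem escapingVector_apply {r : ℝ} (hr : r ∈ Icc (0 : ℝ) 1) (k : ℕ) :
    escapingVector r k = ((√(1 - r ^ 2) * r ^ k : ℝ) : ℂ) := by
  rcases eq_or_lt_of_le hr.2 with rfl | h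
  · simp [escapingVector_one]
  · rw [escapingVector, dif_pos ⟨hr.1, h⟩]

theorem norm_escapingVector {r : ℝ} (hr : r ∈ Ico (0 : ℝ) 1) : ‖escapingVector r‖ = 1 := by
  have h2 : 0 < 1 - r ^ 2 := by nlinarith [hr.1, hr.2]
  have h1 : HasSum (fun k : ℕ => (1 - r ^ 2) * (r ^ 2) ^ k) ((1 - r ^ 2) * (1 - r ^ 2)⁻¹) :=
    (hasSum_geometric_of_lt_one (sq_nonneg r) (by linarith)).mul_left _
  rw [mul_inv_cancel₀ h2.ne'] at h1
  have h3 := lp.hasSum_norm (p := 2) (by norm_num) (escapingVector r)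
  have h4 : (fun k : ℕ => ‖escapingVector r k‖ ^ (2 : ENNReal).toReal) =
      fun k => (1 - r ^ 2) * (r ^ 2) ^ k := by
    funext k
    have h5 : 0 ≤ √(1 - r ^ 2) * r ^ k := mul_nonneg (Real.sqrt_nonneg _) (pow_nonneg hr.1 k)
    rw [escapingVector_apply ⟨hr.1, hr.2.le⟩, Complex.norm_real, Real.norm_of_nonneg h5]
    simp only [ENNReal.toReal_ofNat, Real.rpow_ofNat]
    rw [mul_pow, Real.sq_sqrt h2.le]
    ring
  rw [h4] at h3
  have h6 := h3.unique h1
  simp only [ENNReal.toReal_ofNat, Real.rpow_ofNat] at h6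
  rwa [pow_eq_one_iff_of_nonneg (norm_nonneg _) two_ne_zero] at h6

end EscapingVector

/-! ### Total sets and separability of Hilbert sums -/

section Density

theorem lp_topologicalClosure_span_single {ι : Type*} [DecidableEq ι] {G : ι → Type*}
    [∀ i, NormedAddCommGroup (G i)] [∀ i, InnerProductSpace ℂ (G i)] [∀ i, CompleteSpace (G i)] :
    (Submodule.span ℂ (⋃ i, Set.range (lp.single 2 i : G i → lp G 2))).topologicalClosure = ⊤ := by
  rw [Submodule.topologicalClosure_eq_top_iff, eq_bot_iff]
  intro w hw
  rw [Submodule.mem_bot]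
  ext i
  have h := (Submodule.mem_orthogonal _ _).1 hw (lp.single 2 i (w i))
    (Submodule.subset_span (mem_iUnion.2 ⟨i, mem_range_self _⟩))
  rw [lp.inner_single_left, inner_self_eq_zero] at h
  simpa using h

theorem separableSpace_of_topologicalClosure_span {K : Type*} [NormedAddCommGroup K]
    [InnerProductSpace ℂ K] {D : Set K} (hD : TopologicalSpace.IsSeparable D)
    (hs : (Submodule.span ℂ D).topologicalClosure = ⊤) : SeparableSpace K := by
  rw [← isSeparable_univ_iff]
  have h := hD.span (R := ℂ) |>.closure
  rwa [← Submodule.topologicalClosure_coe, hs] at h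

theorem separableSpace_lp {ι : Type*} [Countable ι] {G : ι → Type*}
    [∀ i, NormedAddCommGroup (G i)] [∀ i, InnerProductSpace ℂ (G i)] [∀ i, CompleteSpace (G i)]
    [∀ i, SeparableSpace (G i)] : SeparableSpace (lp G 2) := by
  classical
  refine separableSpace_of_topologicalClosure_span (TopologicalSpace.IsSeparable.iUnion fun i => ?_)
    lp_topologicalClosure_span_single
  refine isSeparable_range ?_
  exact (lp.isometry_single i).continuous

end Density

/-! ### The field of subspaces over one ball -/

section Block

variable {F : Type*} [NormedAddCommGroup F] [InnerProductSpace ℂ F]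

/-- The space in which `blockSubspace` varies. -/
abbrev BlockSpace (F : Type*) [NormedAddCommGroup F] : Type _ :=
  WithLp 2 (F × lp (fun _ : ℕ => ℂ) 2)

/-- The unit vector `(x, √(1 - ‖x‖²) η)`, with `η` the escaping vector at `‖x‖`. -/
def blockVector (x : F) : BlockSpace F :=
  WithLp.toLp 2 (x, ((√(1 - ‖x‖ ^ 2) : ℝ) : ℂ) • escapingVector ‖x‖)

/-- The orthogonal complement of `blockVector x` in `F ⊕ ℂ η`, with `η` the escaping vector
at `‖x‖`. -/
def blockSubspace (x : F) : Submodule ℂ (BlockSpace F) where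
  carrier := {v | inner ℂ (escapingVector ‖x‖) v.snd • escapingVector ‖x‖ = v.snd ∧
    inner ℂ (blockVector x) v = 0}
  add_mem' := by
    rintro a b ⟨ha, ha'⟩ ⟨hb, hb'⟩
    refine ⟨?_, by rw [inner_add_right, ha', hb', add_zero]⟩
    rw [WithLp.add_snd, inner_add_right, add_smul, ha, hb]
  zero_mem' := by simp
  smul_mem' := by
    rintro c a ⟨ha, ha'⟩
    refine ⟨?_, by rw [inner_smul_right, ha', mul_zero]⟩
    rw [WithLp.smul_snd, inner_smul_right, mul_smul, ha]

theorem blockSpace_inner (a b : BlockSpace F) :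
    inner ℂ a b = inner ℂ a.fst b.fst + inner ℂ a.snd b.snd := WithLp.prod_inner_apply a b

theorem blockVector_fst {F : Type*} [NormedAddCommGroup F] (x : F) : (blockVector x).fst = x := rfl

theorem blockVector_snd {F : Type*} [NormedAddCommGroup F] (x : F) :
    (blockVector x).snd = ((√(1 - ‖x‖ ^ 2) : ℝ) : ℂ) • escapingVector ‖x‖ := rfl

theorem blockSpace_ext {F : Type*} [NormedAddCommGroup F] {a b : BlockSpace F}
    (h1 : a.fst = b.fst) (h2 : a.snd = b.snd) : a = b :=
  WithLp.ofLp_injective 2 (Prod.ext h1 h2)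

theorem inner_blockVector (x : F) (v : BlockSpace F) : inner ℂ (blockVector x) v =
    inner ℂ x v.fst + √(1 - ‖x‖ ^ 2) * inner ℂ (escapingVector ‖x‖) v.snd := by
  rw [blockSpace_inner, blockVector_fst, blockVector_snd, inner_smul_left, Complex.conj_ofReal]

theorem escapingVector_norm_cases {F : Type*} [NormedAddCommGroup F] {x : F} (hx : ‖x‖ ≤ 1) :
    (‖x‖ = 1 ∧ escapingVector ‖x‖ = 0 ∧ √(1 - ‖x‖ ^ 2) = 0) ∨
      (inner ℂ (escapingVector ‖x‖) (escapingVector ‖x‖) = 1 ∧ √(1 - ‖x‖ ^ 2) ≠ 0) := by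
  rcases eq_or_lt_of_le hx with h | h
  · left
    simp [h, escapingVector_one]
  · right
    constructor
    · rw [inner_self_eq_norm_sq_to_K, norm_escapingVector ⟨norm_nonneg x, h⟩]
      simp
    · refine (Real.sqrt_pos.2 ?_).ne'
      nlinarith [norm_nonneg x]

theorem inner_blockVector_self {x : F} (hx : ‖x‖ ≤ 1) :
    inner ℂ (blockVector x) (blockVector x) = 1 := by
  rw [inner_blockVector]
  rw [blockVector_fst, blockVector_snd, inner_smul_right, inner_self_eq_norm_sq_to_K (𝕜 := ℂ) x]
  rcases escapingVector_norm_cases hx with ⟨h1, h2, h3⟩ | ⟨h1, -⟩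
  · rw [h3, h1]; simp
  · rw [h1, mul_one, ← Complex.ofReal_mul, Real.mul_self_sqrt (by nlinarith [norm_nonneg x])]
    simp

/-- The second component is a multiple of `η`. For `‖x‖ < 1` orthogonality to the block vector
determines the multiple from the first component; for `‖x‖ = 1`, `η` is 0. -/
theorem fst_ne_zero_of_mem_blockSubspace {x : F} (hx : ‖x‖ ≤ 1) {v : BlockSpace F}
    (hv : v ∈ blockSubspace x) (h0 : v.fst = 0) : v = 0 := by
  obtain ⟨h1, h2⟩ := hv
  rw [inner_blockVector, h0, inner_zero_right, zero_add] at h2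
  have hsnd : v.snd = 0 := by
    rcases escapingVector_norm_cases hx with ⟨-, h3, -⟩ | ⟨-, h3⟩
    · rw [← h1, h3, smul_zero]
    · rw [← h1, (mul_eq_zero.1 h2).resolve_left (by exact_mod_cast h3), zero_smul]
  exact blockSpace_ext h0 hsnd

theorem inner_fst_eq_zero_of_mem_blockSubspace {x : F} (hx : ‖x‖ = 1) {v : BlockSpace F}
    (hv : v ∈ blockSubspace x) : inner ℂ x v.fst = 0 := by
  have h2 := hv.2
  rw [inner_blockVector, hx] at h2
  simpa using h2

/-- The block vector lies in `F ⊕ ℂ η`, so the projection is that of `F ⊕ ℂ η` minus that of the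
line of the block vector. -/
theorem starProjection_blockSubspace {x : F} (hx : ‖x‖ ≤ 1)
    [(blockSubspace x).HasOrthogonalProjection] (v : BlockSpace F) :
    (blockSubspace x).starProjection v =
      WithLp.toLp 2 (v.fst, inner ℂ (escapingVector ‖x‖) v.snd • escapingVector ‖x‖) -
        inner ℂ (blockVector x) v • blockVector x := by
  refine Submodule.eq_starProjection_of_mem_of_inner_eq_zero ⟨?_, ?_⟩ fun w hw => ?_
  · rw [WithLp.sub_snd, WithLp.smul_snd, blockVector_snd]
    change inner ℂ _ (inner ℂ (escapingVector ‖x‖) v.snd • escapingVector ‖x‖ - _) • _ =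
      inner ℂ (escapingVector ‖x‖) v.snd • escapingVector ‖x‖ - _
    simp only [inner_sub_right, inner_smul_right]
    rcases escapingVector_norm_cases hx with ⟨-, h3, -⟩ | ⟨h3, -⟩
    · simp [h3]
    · rw [h3]
      module
  · rw [inner_sub_right, inner_smul_right, inner_blockVector_self hx, inner_blockVector,
      inner_blockVector]
    change inner ℂ x v.fst + _ * inner ℂ _ (inner ℂ (escapingVector ‖x‖) v.snd •
      escapingVector ‖x‖) - _ = 0
    rw [inner_smul_right]
    rcases escapingVector_norm_cases hx with ⟨-, h3, -⟩ | ⟨h3, -⟩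
    · simp [h3]
    · rw [h3]
      ring
  · obtain ⟨h1, h2⟩ := hw
    rw [sub_sub_eq_add_sub, add_sub_right_comm, inner_add_left, inner_smul_left, h2, mul_zero,
      add_zero, blockSpace_inner, WithLp.sub_fst, WithLp.sub_snd]
    change inner ℂ (v.fst - v.fst) _ + inner ℂ (v.snd -
      inner ℂ (escapingVector ‖x‖) v.snd • escapingVector ‖x‖) _ = 0
    rw [sub_self, inner_zero_left, zero_add, ← h1, inner_smul_right, inner_sub_left, inner_smul_left, inner_conj_symm]
    rcases escapingVector_norm_cases hx with ⟨-, h3, -⟩ | ⟨h3, -⟩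
    · simp [h3]
    · rw [h3]
      simp

theorem continuous_inner_single_escapingVector {F : Type*} [NormedAddCommGroup F] (k : ℕ) (a : ℂ) :
    Continuous fun x : closedBall (0 : F) 1 =>
      inner ℂ (lp.single 2 k a : lp (fun _ : ℕ => ℂ) 2) (escapingVector ‖(x : F)‖) := by
  have h : ∀ x : closedBall (0 : F) 1,
      inner ℂ (lp.single 2 k a : lp (fun _ : ℕ => ℂ) 2) (escapingVector ‖(x : F)‖) =
        inner ℂ a ((√(1 - ‖(x : F)‖ ^ 2) * ‖(x : F)‖ ^ k : ℝ) : ℂ) := fun x => by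
    rw [lp.inner_single_left, escapingVector_apply ⟨norm_nonneg _, mem_closedBall_zero_iff.1 x.2⟩]
  simp only [h]
  exact continuous_const.inner (Complex.continuous_ofReal.comp (by fun_prop))

theorem isClosed_blockSubspace (x : F) : IsClosed (blockSubspace x : Set (BlockSpace F)) := by
  have h : (blockSubspace x : Set (BlockSpace F)) =
      {v | inner ℂ (escapingVector ‖x‖) v.snd • escapingVector ‖x‖ = v.snd} ∩
        {v | inner ℂ (blockVector x) v = 0} := rfl
  rw [h]
  exact (isClosed_eq (by fun_prop) (by fun_prop)).inter (isClosed_eq (by fun_prop) (by fun_prop))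

/-- A vector `y` of `F` orthogonal to `x` gives `(y, 0)`. Dimension at least 2 is needed at the
boundary, where the block is just the complement of `x` in `F`. -/
theorem exists_mem_blockSubspace_ne_zero [FiniteDimensional ℂ F] (hF : 1 < Module.finrank ℂ F)
    (x : F) : ∃ v ∈ blockSubspace x, v ≠ 0 := by
  have : (ℂ ∙ x)ᗮ ≠ ⊥ := by
    intro h
    rw [Submodule.orthogonal_eq_bot_iff] at h
    have h1 := finrank_span_le_card (R := ℂ) ({x} : Set F)
    rw [Set.toFinset_singleton, Finset.card_singleton] at h1
    rw [h, finrank_top] at h1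
    omega
  obtain ⟨y, hy, hy0⟩ := Submodule.exists_mem_ne_zero_of_ne_bot this
  refine ⟨WithLp.toLp 2 (y, 0), ⟨by simp, ?_⟩, fun h => hy0 (congrArg WithLp.fst h)⟩
  rw [inner_blockVector]
  simpa using (Submodule.mem_orthogonal_singleton_iff_inner_right.1 hy)

variable [CompleteSpace F]

instance (x : F) : CompleteSpace (blockSubspace x) :=
  (isClosed_blockSubspace x).completeSpace_coe

theorem continuous_starProjection_blockSubspace (v : BlockSpace F) :
    Continuous fun x : closedBall (0 : F) 1 => (blockSubspace (x : F)).starProjection v := by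
  -- Only the coefficients of `η` enter the projection formula. They are continuous against `F` and
  -- the coordinate vectors of `ℓ²`, which together are total.
  let D : Set (BlockSpace F) := {d | Continuous fun x : closedBall (0 : F) 1 =>
    inner ℂ d.snd (escapingVector ‖(x : F)‖)}
  have hDu : ∀ d ∈ D, Continuous fun x : closedBall (0 : F) 1 => inner ℂ d (blockVector (x : F)) := by
    intro d hd
    have h1 : Continuous fun x : closedBall (0 : F) 1 =>
        inner ℂ d.fst (x : F) + √(1 - ‖(x : F)‖ ^ 2) * inner ℂ d.snd (escapingVector ‖(x : F)‖) :=
      (continuous_const.inner continuous_subtype_val).add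
        ((Complex.continuous_ofReal.comp (by fun_prop)).mul hd)
    refine h1.congr fun x => ?_
    rw [blockSpace_inner, blockVector_fst, blockVector_snd, inner_smul_right]
  refine continuous_starProjection_of_inner (D := D) ?_ (fun d hd d' hd' => ?_) v
  · rw [Submodule.topologicalClosure_eq_top_iff, eq_bot_iff]
    intro w hw
    rw [Submodule.mem_orthogonal] at hw
    have h1 := hw (WithLp.toLp 2 (w.fst, 0)) (Submodule.subset_span (by
      simpa [D] using continuous_const))
    have h2 : ∀ k, w.snd k = 0 := fun k => by
      have h3 := hw (WithLp.toLp 2 (0, lp.single 2 k (w.snd k)))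
        (Submodule.subset_span (continuous_inner_single_escapingVector k _))
      rw [blockSpace_inner] at h3
      change inner ℂ (0 : F) _ + inner ℂ (lp.single 2 k (w.snd k)) w.snd = 0 at h3
      rwa [inner_zero_left, zero_add, lp.inner_single_left, inner_self_eq_zero] at h3
    rw [blockSpace_inner] at h1
    change inner ℂ w.fst w.fst + inner ℂ (0 : lp (fun _ : ℕ => ℂ) 2) _ = 0 at h1
    rw [inner_zero_left, add_zero, inner_self_eq_zero] at h1
    exact blockSpace_ext h1 (lp.ext (funext h2))
  · have h1 : Continuous fun x : closedBall (0 : F) 1 =>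
        inner ℂ d.fst d'.fst + star (inner ℂ d'.snd (escapingVector ‖(x : F)‖)) *
          inner ℂ d.snd (escapingVector ‖(x : F)‖) -
          star (inner ℂ d' (blockVector (x : F))) * inner ℂ d (blockVector (x : F)) :=
      (continuous_const.add (hd'.star.mul hd)).sub ((hDu d' hd').star.mul (hDu d hd))
    refine h1.congr fun x => ?_
    rw [starProjection_blockSubspace (mem_closedBall_zero_iff.1 x.2), inner_sub_right,
      inner_smul_right, blockSpace_inner d (WithLp.toLp 2 _)]
    change _ = _ + inner ℂ d.snd (_ • _) - _
    simp only [inner_smul_right, RCLike.star_def, inner_conj_symm]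
    rfl

end Block

/-! ### The Hilbert sum of the blocks over a countable product of balls -/

section ProductField

variable {F : Type*} [NormedAddCommGroup F] [InnerProductSpace ℂ F]

/-- The Hilbert sum of countably many copies of `BlockSpace F`. -/
abbrev ProductSpace (F : Type*) [NormedAddCommGroup F] [InnerProductSpace ℂ F] : Type _ :=
  lp (fun _ : ℕ => BlockSpace F) 2

/-- The Hilbert sum of the subspaces `blockSubspace (x n)`. -/
def productSubspace (x : ℕ → closedBall (0 : F) 1) : Submodule ℂ (ProductSpace F) where
  carrier := {w | ∀ n, w n ∈ blockSubspace (x n : F)}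
  add_mem' ha hb n := add_mem (ha n) (hb n)
  zero_mem' _ := zero_mem _
  smul_mem' c _ ha n := Submodule.smul_mem _ c (ha n)

theorem mem_productSubspace {x : ℕ → closedBall (0 : F) 1} {w : ProductSpace F} :
    w ∈ productSubspace x ↔ ∀ n, w n ∈ blockSubspace (x n : F) := Iff.rfl

theorem single_mem_productSubspace {x : ℕ → closedBall (0 : F) 1} {n : ℕ} {v : BlockSpace F}
    (hv : v ∈ blockSubspace (x n : F)) :
    (lp.single 2 n v : ProductSpace F) ∈ productSubspace x := by
  intro m
  rcases eq_or_ne m n with rfl | h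
  · rwa [lp.single_apply_self]
  · rw [lp.single_apply_ne _ _ _ h]
    exact zero_mem _

theorem single_mem_productSubspace_orthogonal {x : ℕ → closedBall (0 : F) 1} {n : ℕ}
    {v : BlockSpace F} (hv : v ∈ (blockSubspace (x n : F))ᗮ) :
    (lp.single 2 n v : ProductSpace F) ∈ (productSubspace x)ᗮ := by
  rw [Submodule.mem_orthogonal]
  intro w hw
  rw [lp.inner_single_right]
  exact (Submodule.mem_orthogonal _ _).1 hv _ (hw n)

theorem continuous_lp_apply {G : Type*} [NormedAddCommGroup G] [NormedSpace ℂ G] (n : ℕ) :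
    Continuous fun w : lp (fun _ : ℕ => G) 2 => w n :=
  (lp.evalCLM ℂ (fun _ : ℕ => G) (p := 2) n).continuous

theorem isClosed_productSubspace (x : ℕ → closedBall (0 : F) 1) :
    IsClosed (productSubspace x : Set (ProductSpace F)) := by
  have h : (productSubspace x : Set (ProductSpace F)) =
      ⋂ n, (fun w : ProductSpace F => w n) ⁻¹' (blockSubspace (x n : F)) := by
    ext w
    simp [mem_productSubspace]
  rw [h]
  exact isClosed_iInter fun n => (isClosed_blockSubspace _).preimage (continuous_lp_apply n)

theorem not_finiteDimensional_of_single {S : Submodule ℂ (ProductSpace F)}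
    (h : ∀ n, ∃ v : BlockSpace F, v ≠ 0 ∧ (lp.single 2 n v : ProductSpace F) ∈ S) :
    ¬ FiniteDimensional ℂ S := by
  intro hfin
  choose v hv hvS using h
  have hli : LinearIndependent ℂ fun n : ℕ => (lp.single 2 n (v n) : ProductSpace F) := by
    refine linearIndependent_of_ne_zero_of_inner_eq_zero (fun n h0 => hv n ?_) fun m n hmn => ?_
    · have := congrArg (fun w : ProductSpace F => w n) h0
      simpa using this
    · change inner ℂ (lp.single 2 m (v m) : ProductSpace F) (lp.single 2 n (v n)) = 0
      rw [lp.inner_single_left, lp.single_apply_ne _ _ _ hmn, inner_zero_right]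
  have hli' : LinearIndependent ℂ fun n : ℕ => (⟨_, hvS n⟩ : S) :=
    LinearIndependent.of_comp S.subtype hli
  exact not_finite_iff_infinite.2 inferInstance hli'.finite

/-- The first components of a section satisfy the boundary condition of the Brouwer argument, and
where they all vanish the section vanishes. -/
theorem exists_eq_zero_of_mem_productSubspace [FiniteDimensional ℂ F]
    {s : (ℕ → closedBall (0 : F) 1) → ProductSpace F} (hs : Continuous s)
    (hmem : ∀ x, s x ∈ productSubspace x) : ∃ x, s x = 0 := by
  obtain ⟨x, hx⟩ := exists_forall_eq_zero_of_inner_eq_zero' (y := fun n x => (s x n).fst)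
    (fun n => (WithLp.continuous_fst ..).comp ((continuous_lp_apply n).comp hs))
    (fun n x hx => inner_fst_eq_zero_of_mem_blockSubspace hx (hmem x n))
  exact ⟨x, lp.ext (funext fun n => fst_ne_zero_of_mem_blockSubspace
    (mem_closedBall_zero_iff.1 (x n).2) (hmem x n) (hx n))⟩

theorem not_finiteDimensional_productSubspace [FiniteDimensional ℂ F]
    (hF : 1 < Module.finrank ℂ F) (x : ℕ → closedBall (0 : F) 1) :
    ¬ FiniteDimensional ℂ (productSubspace x) :=
  not_finiteDimensional_of_single fun n => by
    obtain ⟨v, hv, hv0⟩ := exists_mem_blockSubspace_ne_zero hF (x n : F)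
    exact ⟨v, hv0, single_mem_productSubspace hv⟩

theorem not_finiteDimensional_productSubspace_orthogonal (x : ℕ → closedBall (0 : F) 1) :
    ¬ FiniteDimensional ℂ (productSubspace x)ᗮ :=
  not_finiteDimensional_of_single fun n => by
    refine ⟨blockVector (x n : F), fun h => ?_, single_mem_productSubspace_orthogonal
      ((Submodule.mem_orthogonal' _ _).2 fun v hv => hv.2)⟩
    have := inner_blockVector_self (mem_closedBall_zero_iff.1 (x n).2)
    rw [h, inner_zero_left] at this
    exact zero_ne_one this

variable [CompleteSpace F]

instance (x : ℕ → closedBall (0 : F) 1) : CompleteSpace (productSubspace x) :=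
  (isClosed_productSubspace x).completeSpace_coe

theorem starProjection_productSubspace_single (x : ℕ → closedBall (0 : F) 1) (n : ℕ)
    (v : BlockSpace F) : (productSubspace x).starProjection (lp.single 2 n v) =
      lp.single 2 n ((blockSubspace (x n : F)).starProjection v) := by
  refine Submodule.eq_starProjection_of_mem_orthogonal
    (single_mem_productSubspace (Submodule.starProjection_apply_mem _ _)) ?_
  rw [← lp.single_sub]
  exact single_mem_productSubspace_orthogonal (Submodule.sub_starProjection_mem_orthogonal _)

theorem continuous_starProjection_productSubspace (w : ProductSpace F) :
    Continuous fun x : ℕ → closedBall (0 : F) 1 => (productSubspace x).starProjection w := by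
  refine continuous_apply_of_mem_closure_span (C := 1)
    (D := ⋃ n, Set.range (lp.single (E := fun _ : ℕ => BlockSpace F) 2 n))
    (fun x => Submodule.starProjection_norm_le _) ?_
    (by rw [lp_topologicalClosure_span_single]; exact Submodule.mem_top)
  intro d hd
  obtain ⟨n, v, rfl⟩ := mem_iUnion.1 hd
  simp only [starProjection_productSubspace_single]
  exact (lp.isometry_single n).continuous.comp
    ((continuous_starProjection_blockSubspace v).comp (continuous_apply n))

instance [FiniteDimensional ℂ F] : SeparableSpace (ProductSpace F) := by
  have : ProperSpace F := FiniteDimensional.proper ℂ F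
  have : SeparableSpace (lp (fun _ : ℕ => ℂ) 2) := separableSpace_lp
  have : SeparableSpace (BlockSpace F) :=
    (WithLp.homeomorphProd 2 F (lp (fun _ : ℕ => ℂ) 2)).symm.surjective.denseRange.separableSpace
      (WithLp.homeomorphProd 2 F (lp (fun _ : ℕ => ℂ) 2)).symm.continuous
  exact separableSpace_lp

end ProductField

/-! ### Separable infinite-dimensional Hilbert spaces are isometric -/

section Isomorphism

variable {K K' : Type*} [NormedAddCommGroup K] [InnerProductSpace ℂ K]
  [NormedAddCommGroup K'] [InnerProductSpace ℂ K']

theorem Orthonormal.countable_of_separableSpace [SeparableSpace K] {w : Set K}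
    (hw : Orthonormal ℂ ((↑) : w → K)) : w.Countable := by
  refine PairwiseDisjoint.countable_of_isOpen (s := fun v : K => ball v (1 / 2)) ?_
    (fun _ _ => isOpen_ball) fun v _ => ⟨v, mem_ball_self (by norm_num)⟩
  intro a ha b hb hab
  refine ball_disjoint_ball ?_
  have h1 : inner ℂ a b = 0 := hw.2 (i := ⟨a, ha⟩) (j := ⟨b, hb⟩) (by simpa using hab)
  have h2 := norm_sub_sq (𝕜 := ℂ) a b
  rw [h1, hw.1 ⟨a, ha⟩, hw.1 ⟨b, hb⟩] at h2
  norm_num at h2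
  rw [dist_eq_norm]
  nlinarith [norm_nonneg (a - b)]

theorem exists_hilbertBasis_nat [CompleteSpace K] [SeparableSpace K]
    (hK : ¬ FiniteDimensional ℂ K) : Nonempty (HilbertBasis ℕ ℂ K) := by
  obtain ⟨w, b, hb⟩ := exists_hilbertBasis ℂ K
  have hon : Orthonormal ℂ ((↑) : w → K) := hb ▸ b.orthonormal
  have : Countable w := hon.countable_of_separableSpace
  have : Infinite w := by
    rw [← not_finite_iff_infinite]
    intro hfin
    have := Fintype.ofFinite w
    exact hK b.toOrthonormalBasis.toBasis.finiteDimensional_of_finite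
  obtain ⟨e⟩ := nonempty_equiv_of_countable (α := ℕ) (β := w)
  refine ⟨HilbertBasis.mk (hon.comp e e.injective) ?_⟩
  rw [Set.range_comp, e.surjective.range_eq, Set.image_univ, ← hb, b.dense_span]

theorem exists_linearIsometryEquiv [CompleteSpace K] [SeparableSpace K]
    (hK : ¬ FiniteDimensional ℂ K) [CompleteSpace K'] [SeparableSpace K']
    (hK' : ¬ FiniteDimensional ℂ K') : Nonempty (K ≃ₗᵢ[ℂ] K') := by
  obtain ⟨b⟩ := exists_hilbertBasis_nat hK
  obtain ⟨b'⟩ := exists_hilbertBasis_nat hK'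
  exact ⟨b.repr.trans b'.repr.symm⟩

end Isomorphism

/-! ### Intertwining maps and multiplicity spaces -/

namespace StableHom

section

variable {E H K : Type*} [NormedAddCommGroup E] [NormedSpace ℂ E] [CompleteSpace E]
  [NormedAddCommGroup H] [InnerProductSpace ℂ H] [CompleteSpace H] [SeparableSpace H]
  [NormedAddCommGroup K] [InnerProductSpace ℂ K] [CompleteSpace K] [SeparableSpace K]

/-- Being bounded below on `P`, `f` has closed image there; this image is a separable
infinite-dimensional Hilbert space, hence a copy of `K`. Later `P` is a space of intertwining maps
and `f` is evaluation at a frame vector. -/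
theorem exists_linearEquiv_submodule_of_antilipschitz {P : Submodule ℂ E}
    (hP : IsClosed (P : Set E)) (hPinf : ¬ FiniteDimensional ℂ P) (f : E →L[ℂ] H) {C : NNReal}
    (hf : ∀ T ∈ P, ‖T‖ ≤ C * ‖f T‖) (hK : ¬ FiniteDimensional ℂ K) :
    ∃ e : K ≃ₗ[ℂ] P, ∀ a b, inner ℂ (f (e a)) (f (e b)) = inner ℂ a b := by
  have : CompleteSpace P := hP.completeSpace_coe
  let ev : P →L[ℂ] H := f.comp P.subtypeL
  have hanti : AntilipschitzWith C ev :=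
    AddMonoidHomClass.antilipschitz_of_bound ev fun T => hf T.1 T.2
  have hclosed : IsClosed (Set.range ev) := hanti.isClosed_range ev.uniformContinuous
  let M : Submodule ℂ H := LinearMap.range (ev : P →ₗ[ℂ] H)
  have : CompleteSpace M := IsClosed.completeSpace_coe (s := Set.range ev) (hs := hclosed)
  let e : P ≃ₗ[ℂ] M := LinearEquiv.ofInjective (ev : P →ₗ[ℂ] H) hanti.injective
  have he : ∀ m, f (e.symm m) = m := fun m => congrArg Subtype.val (e.apply_symm_apply m)
  have hMinf : ¬ FiniteDimensional ℂ M := fun h => hPinf e.symm.finiteDimensional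
  obtain ⟨A⟩ := exists_linearIsometryEquiv hK hMinf
  refine ⟨A.toLinearEquiv.trans e.symm, fun a b => ?_⟩
  change inner ℂ (f (e.symm (A a))) (f (e.symm (A b))) = _
  rw [he, he, ← Submodule.coe_inner, A.inner_map_map]

end

section Intertwiners

variable {G H : Type*} [Group G] [TopologicalSpace G] [NormedAddCommGroup H]
  [InnerProductSpace ℂ H] [CompleteSpace H]

theorem UH.inner_op_op (F : UH H) (x y : H) : inner ℂ (F.op x) (F.op y) = inner ℂ x y :=
  ContinuousLinearMap.inner_map_map_of_mem_unitary
    (Subtype.prop (p := fun T => T ∈ unitary (H →L[ℂ] H)) F) x y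

theorem UH.inner_op_left (F : UH H) (x y : H) :
    inner ℂ (F.op x) y = inner ℂ x (F⁻¹.op y) := by
  rw [← F⁻¹.inner_op_op, UH.op_inv_op]

variable {α : G →ₜ* UH H} {V : IrrepObj G}

theorem intertwiningMap_apply (j : V.rep.IntertwiningMap (repOf α)) (g : G)
    (w : Fin V.dim → ℂ) : j (V.rep g w) = (α g).op (j w) :=
  LinearMap.congr_fun (j.isIntertwining' g) w

theorem inner_intertwiningMap_apply (j k : V.rep.IntertwiningMap (repOf α)) (g : G)
    (v w : Fin V.dim → ℂ) : inner ℂ (j (V.rep g v)) (k (V.rep g w)) = inner ℂ (j v) (k w) := by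
  rw [intertwiningMap_apply, intertwiningMap_apply, UH.inner_op_op]

/-- A family of vectors that a given nonzero intertwining map sends to an orthonormal basis of
its range. -/
structure IsFrame (j₀ : V.rep.IntertwiningMap (repOf α)) {n : ℕ}
    (v : Fin n → Fin V.dim → ℂ) : Prop where
  pos : 0 < n
  inner_eq : ∀ i l, inner ℂ (j₀ (v i)) (j₀ (v l)) = if i = l then (1 : ℂ) else 0
  sum_eq : ∀ w, ∑ i, inner ℂ (j₀ (v i)) (j₀ w) • v i = w

theorem injective_of_ne_zero {j₀ : V.rep.IntertwiningMap (repOf α)} (hj₀ : j₀ ≠ 0) :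
    Function.Injective j₀ :=
  have := V.irreducible
  (Representation.IsIrreducible.injective_or_eq_zero j₀).resolve_right hj₀

theorem exists_isFrame {j₀ : V.rep.IntertwiningMap (repOf α)} (hj₀ : j₀ ≠ 0) :
    ∃ (n : ℕ) (v : Fin n → Fin V.dim → ℂ), IsFrame j₀ v := by
  have hinj : Function.Injective j₀.toLinearMap := injective_of_ne_zero hj₀
  let e := LinearEquiv.ofInjective j₀.toLinearMap hinj
  let b := stdOrthonormalBasis ℂ (LinearMap.range j₀.toLinearMap)
  have hb : ∀ i, j₀ (e.symm (b i)) = b i := fun i =>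
    congrArg Subtype.val (e.apply_symm_apply (b i))
  refine ⟨_, fun i => e.symm (b i), ⟨?_, fun i l => ?_, fun w => hinj ?_⟩⟩
  · rw [Module.finrank_pos_iff_exists_ne_zero]
    obtain ⟨w, hw⟩ : ∃ w, j₀ w ≠ 0 := by
      by_contra! h
      exact hj₀ (Representation.IntertwiningMap.ext (LinearMap.ext h))
    exact ⟨e w, fun h => hw (congrArg Subtype.val h)⟩
  · rw [hb, hb, ← Submodule.coe_inner, orthonormal_iff_ite.1 b.orthonormal]
  · rw [map_sum]
    have h := congrArg Subtype.val (b.sum_repr' (e w))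
    rw [Submodule.coe_sum] at h
    refine (Finset.sum_congr rfl fun i _ => ?_).trans h
    rw [map_smul, Submodule.coe_smul, Submodule.coe_inner]
    change inner ℂ (j₀ (e.symm (b i))) (j₀ w) • j₀ (e.symm (b i)) = _
    rw [hb]
    rfl

/-- **Schur's lemma** for the sesquilinear forms defined by pairs of intertwining maps. -/
theorem exists_inner_intertwiningMap_eq {j₀ : V.rep.IntertwiningMap (repOf α)} (hj₀ : j₀ ≠ 0)
    (j k : V.rep.IntertwiningMap (repOf α)) :
    ∃ c : ℂ, ∀ v w, inner ℂ (j v) (k w) = c * inner ℂ (j₀ v) (j₀ w) := by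
  have := V.irreducible
  obtain ⟨n, v, hv⟩ := exists_isFrame hj₀
  -- `A` represents the form of `j`, `k` relative to the inner product pulled back along `j₀`. Both
  -- forms are invariant, so `A` commutes with `G` and is a scalar.
  let A : (Fin V.dim → ℂ) →ₗ[ℂ] (Fin V.dim → ℂ) :=
    ∑ i, ((innerSL ℂ (j (v i)) : H →ₗ[ℂ] ℂ) ∘ₗ k.toLinearMap).smulRight (v i)
  have hA : ∀ w, A w = ∑ i, inner ℂ (j (v i)) (k w) • v i := fun w => by
    simp only [A, LinearMap.sum_apply]
    rfl
  have hjA : ∀ u w, inner ℂ (j u) (k w) = inner ℂ (j₀ u) (j₀ (A w)) := by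
    intro u w
    conv_lhs => rw [← hv.sum_eq u, map_sum, sum_inner]
    rw [hA, map_sum, inner_sum]
    refine Finset.sum_congr rfl fun i _ => ?_
    rw [map_smul, map_smul, inner_smul_left, inner_smul_right, inner_conj_symm, mul_comm]
  have hcomm : ∀ g w, A (V.rep g w) = V.rep g (A w) := by
    intro g w
    apply injective_of_ne_zero hj₀
    rw [← sub_eq_zero, ← map_sub, ← inner_self_eq_zero (𝕜 := ℂ)]
    set d := A (V.rep g w) - V.rep g (A w) with hd
    conv_lhs => enter [3]; rw [hd, map_sub]
    have hdg : d = V.rep g (V.rep g⁻¹ d) := by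
      rw [← Module.End.mul_apply, ← map_mul, mul_inv_cancel, map_one, Module.End.one_apply]
    rw [inner_sub_right, ← hjA, hdg, inner_intertwiningMap_apply, inner_intertwiningMap_apply,
      hjA, sub_self]
  let A' : V.rep.IntertwiningMap V.rep := ⟨A, fun g => LinearMap.ext (hcomm g)⟩
  obtain ⟨c, hc⟩ := (Representation.IsIrreducible.algebraMap_intertwiningMap_bijective_of_isAlgClosed
    (ρ := V.rep)).2 A'
  refine ⟨c, fun u w => ?_⟩
  have hAw : A w = c • w := by
    change A' w = c • w
    rw [← hc, Algebra.algebraMap_eq_smul_one]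
    rfl
  rw [hjA, hAw, map_smul, inner_smul_right]

/-- The first frame vector has norm 1 under `j₀`, so the Schur scalar is read off by evaluating
there. -/
theorem IsFrame.inner_intertwiningMap {j₀ : V.rep.IntertwiningMap (repOf α)} {n : ℕ}
    {v : Fin n → Fin V.dim → ℂ} (hv : IsFrame j₀ v) (hj₀ : j₀ ≠ 0)
    (j k : V.rep.IntertwiningMap (repOf α)) (u w : Fin V.dim → ℂ) :
    inner ℂ (j u) (k w) =
      inner ℂ (j (v ⟨0, hv.pos⟩)) (k (v ⟨0, hv.pos⟩)) * inner ℂ (j₀ u) (j₀ w) := by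
  obtain ⟨c, hc⟩ := exists_inner_intertwiningMap_eq hj₀ j k
  rw [hc u w, hc (v ⟨0, hv.pos⟩), hv.inner_eq, if_pos rfl, mul_one]

variable (α V) in
/-- The intertwining maps from `V` to `H_α`, as a space of continuous linear maps. -/
def homSpace : Submodule ℂ ((Fin V.dim → ℂ) →L[ℂ] H) where
  carrier := {T | ∀ g w, T (V.rep g w) = (α g).op (T w)}
  add_mem' ha hb g w := by
    rw [add_apply, ha, hb, add_apply, map_add]
  zero_mem' g w := by simp
  smul_mem' c T hT g w := by
    rw [smul_apply, hT, smul_apply, map_smul]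

/-- The intertwining map given by an element of `homSpace α V`. -/
def homSpace.toIntertwiningMap (T : homSpace α V) : V.rep.IntertwiningMap (repOf α) :=
  ⟨T.1, fun g => LinearMap.ext (T.2 g)⟩

theorem exists_homSpace_apply (j : V.rep.IntertwiningMap (repOf α)) :
    ∃ T : homSpace α V, ∀ w, T.1 w = j w :=
  ⟨⟨j.toLinearMap.toContinuousLinearMap, fun g w => intertwiningMap_apply j g w⟩, fun _ => rfl⟩

theorem isClosed_homSpace :
    IsClosed (homSpace α V : Set ((Fin V.dim → ℂ) →L[ℂ] H)) := by
  have h : (homSpace α V : Set ((Fin V.dim → ℂ) →L[ℂ] H)) =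
      ⋂ g, ⋂ w, {T | T (V.rep g w) = (α g).op (T w)} := by
    ext T
    simp only [mem_iInter]
    rfl
  rw [h]
  exact isClosed_iInter fun g => isClosed_iInter fun w => isClosed_eq (by fun_prop) (by fun_prop)

/-- The isotypical component lies in the sum of the images of `homSpace α V` under evaluation at the
finitely many basis vectors of `V`. -/
theorem not_finiteDimensional_homSpace (h : ¬ FiniteDimensional ℂ (isotypical α V)) :
    ¬ FiniteDimensional ℂ (homSpace α V) := by
  intro hfin
  refine h ?_
  let S : Fin V.dim → Submodule ℂ H := fun i =>
    (homSpace α V).map (ContinuousLinearMap.apply ℂ H (Pi.single i (1 : ℂ) : Fin V.dim → ℂ) :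
      ((Fin V.dim → ℂ) →L[ℂ] H) →ₗ[ℂ] H)
  have hle : isotypical α V ≤ ⨆ i, S i := by
    refine iSup_le fun f => ?_
    rintro _ ⟨w, rfl⟩
    obtain ⟨T, hT⟩ := exists_homSpace_apply f
    change f w ∈ _
    rw [← hT, pi_eq_sum_univ' w, map_sum]
    refine Submodule.sum_mem _ fun i _ => ?_
    rw [map_smul]
    refine Submodule.smul_mem _ _ (Submodule.mem_iSup_of_mem i ⟨T.1, T.2, ?_⟩)
    change T.1 _ = T.1 _
    congr 1
  exact Submodule.finiteDimensional_of_le hle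

section Frame

variable {j₀ : V.rep.IntertwiningMap (repOf α)} {n : ℕ} {v : Fin n → Fin V.dim → ℂ}

theorem IsFrame.inner_homSpace (hv : IsFrame j₀ v) (hj₀ : j₀ ≠ 0) (S T : homSpace α V)
    (u w : Fin V.dim → ℂ) : inner ℂ (S.1 u) (T.1 w) =
      inner ℂ (S.1 (v ⟨0, hv.pos⟩)) (T.1 (v ⟨0, hv.pos⟩)) * inner ℂ (j₀ u) (j₀ w) :=
  hv.inner_intertwiningMap hj₀ (homSpace.toIntertwiningMap S) (homSpace.toIntertwiningMap T) u w

theorem IsFrame.norm_homSpace (hv : IsFrame j₀ v) (hj₀ : j₀ ≠ 0) (T : homSpace α V)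
    (w : Fin V.dim → ℂ) : ‖T.1 w‖ = ‖T.1 (v ⟨0, hv.pos⟩)‖ * ‖j₀ w‖ := by
  have h := hv.inner_homSpace hj₀ T T w w
  simp only [inner_self_eq_norm_sq_to_K] at h
  refine (pow_left_inj₀ (norm_nonneg _) (by positivity) two_ne_zero).1 ?_
  rw [mul_pow]
  exact_mod_cast h

theorem IsFrame.exists_norm_homSpace_le (hv : IsFrame j₀ v) (hj₀ : j₀ ≠ 0) :
    ∃ C : NNReal, ∀ T ∈ homSpace α V, ‖T‖ ≤ C * ‖T (v ⟨0, hv.pos⟩)‖ := by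
  let J₀ : (Fin V.dim → ℂ) →L[ℂ] H := j₀.toLinearMap.toContinuousLinearMap
  refine ⟨‖J₀‖₊, fun T hT => ?_⟩
  refine ContinuousLinearMap.opNorm_le_bound _ (by positivity) fun w => ?_
  have h1 : ‖T w‖ = ‖T (v ⟨0, hv.pos⟩)‖ * ‖j₀ w‖ := hv.norm_homSpace hj₀ ⟨T, hT⟩ w
  have h2 : ‖j₀ w‖ ≤ ‖J₀‖ * ‖w‖ := J₀.le_opNorm w
  rw [h1, coe_nnnorm]
  nlinarith [norm_nonneg (T (v ⟨0, hv.pos⟩))]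

/-- `K` parametrises all intertwining maps, with the inner product given by evaluation at one frame
vector; `T i` evaluates the map with parameter `a` at the `i`-th frame vector. -/
theorem IsFrame.exists_isometric_family [SeparableSpace H] (hv : IsFrame j₀ v)
    (hj₀ : j₀ ≠ 0) (hinf : ¬ FiniteDimensional ℂ (isotypical α V))
    (K : Type*) [NormedAddCommGroup K] [InnerProductSpace ℂ K] [CompleteSpace K]
    [SeparableSpace K] (hK : ¬ FiniteDimensional ℂ K) :
    ∃ T : Fin n → K →L[ℂ] H,
      (∀ i l a b, inner ℂ (T i a) (T l b) = if i = l then inner ℂ a b else 0) ∧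
      (∀ a, ∃ j : V.rep.IntertwiningMap (repOf α), ∀ i, T i a = j (v i)) ∧
      (∀ j : V.rep.IntertwiningMap (repOf α), ∃ a, ∀ i, j (v i) = T i a) := by
  obtain ⟨C, hC⟩ := hv.exists_norm_homSpace_le hj₀
  have hP := not_finiteDimensional_homSpace hinf
  obtain ⟨e, he⟩ := exists_linearEquiv_submodule_of_antilipschitz
    (E := (Fin V.dim → ℂ) →L[ℂ] H) (P := homSpace α V) isClosed_homSpace hP
    (ContinuousLinearMap.apply ℂ H (v ⟨0, hv.pos⟩)) (C := C) hC hK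
  have hinT : ∀ i l a b, inner ℂ ((e a).1 (v i)) ((e b).1 (v l)) =
      if i = l then inner ℂ a b else 0 := by
    intro i l a b
    have h : inner ℂ ((e a).1 (v ⟨0, hv.pos⟩)) ((e b).1 (v ⟨0, hv.pos⟩)) = inner ℂ a b := he a b
    rw [hv.inner_homSpace hj₀, hv.inner_eq, h]
    split_ifs <;> simp
  have hnorm : ∀ i a, ‖(e a).1 (v i)‖ ≤ 1 * ‖a‖ := by
    intro i a
    have h := hinT i i a a
    rw [if_pos rfl] at h
    simp only [inner_self_eq_norm_sq_to_K] at h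
    rw [one_mul]
    refine ((pow_left_inj₀ (norm_nonneg _) (norm_nonneg _) two_ne_zero).1 ?_).le
    exact_mod_cast h
  let T : Fin n → K →ₗ[ℂ] H := fun i =>
    { toFun := fun a => (e a).1 (v i)
      map_add' := fun a b => by rw [map_add]; rfl
      map_smul' := fun c a => by rw [map_smul]; rfl }
  refine ⟨fun i => (T i).mkContinuous 1 (hnorm i), hinT, fun a => ?_, fun j => ?_⟩
  · exact ⟨homSpace.toIntertwiningMap (e a), fun i => rfl⟩
  · obtain ⟨S, hS⟩ := exists_homSpace_apply j
    refine ⟨e.symm S, fun i => ?_⟩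
    change j (v i) = (e (e.symm S)).1 (v i)
    rw [e.apply_symm_apply, hS]

end Frame

end Intertwiners

/-! ### Fixed vectors -/

section FixedVectors

variable {G H : Type*} [Group G] [TopologicalSpace G] [NormedAddCommGroup H]
  [InnerProductSpace ℂ H] [CompleteSpace H] {α : G →ₜ* UH H}

variable (α) in
/-- The space of the vectors that are fixed by `α`. -/
def fixedVectors : Submodule ℂ H where
  carrier := {h | ∀ g, (α g).op h = h}
  add_mem' ha hb g := by rw [map_add, ha, hb]
  zero_mem' g := map_zero _
  smul_mem' c a ha g := by rw [map_smul, ha]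

theorem isClosed_fixedVectors : IsClosed (fixedVectors α : Set H) := by
  have h : (fixedVectors α : Set H) = ⋂ g, {h | (α g).op h = h} := by
    ext T
    simp only [mem_iInter]
    rfl
  rw [h]
  exact isClosed_iInter fun g => isClosed_eq (by fun_prop) (by fun_prop)

instance : CompleteSpace (fixedVectors α) := isClosed_fixedVectors.completeSpace_coe

theorem isotypical_trivialObj_le : isotypical α (trivialObj G) ≤ fixedVectors α := by
  refine iSup_le fun f => ?_
  rintro _ ⟨w, rfl⟩ g
  exact (intertwiningMap_apply f g w).symm

/-- Pairing with a fixed vector intertwines `V` with the trivial representation, so Schur's lemma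
makes it zero. -/
theorem inner_intertwiningMap_fixedVectors {V : IrrepObj G} (hV : V.cls ≠ trivialIrrep G)
    (j : V.rep.IntertwiningMap (repOf α)) (w : Fin V.dim → ℂ) {h : H}
    (hh : h ∈ fixedVectors α) : inner ℂ h (j w) = 0 := by
  have := V.irreducible
  have : (Representation.trivial ℂ G (Fin 1 → ℂ)).IsIrreducible := (trivialObj G).irreducible
  let f : (Fin V.dim → ℂ) →ₗ[ℂ] (Fin 1 → ℂ) :=
    LinearMap.pi fun _ => (innerSL ℂ h : H →ₗ[ℂ] ℂ) ∘ₗ j.toLinearMap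
  have hf : ∀ u, f u = fun _ => inner ℂ h (j u) := fun u => rfl
  have hcomm : ∀ g u, f (V.rep g u) = f u := fun g u => by
    rw [hf, hf, intertwiningMap_apply]
    conv_lhs => rw [← hh g, UH.inner_op_op]
  let f' : Representation.IntertwiningMap V.rep (Representation.trivial ℂ G (Fin 1 → ℂ)) := { toLinearMap := f, isIntertwining' := fun g => LinearMap.ext (hcomm g) }
  rcases Representation.IsIrreducible.bijective_or_eq_zero f' with hb | h0
  · have e : Nonempty (V.rep.Equiv (trivialObj G).rep) :=
      ⟨Representation.IntertwiningMap.ofBijective f' hb⟩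
    exact absurd (Quotient.sound e) hV
  · have h1 : f' w = 0 := by rw [h0]; rfl
    exact congrFun h1 (0 : Fin 1)

/-- The Hilbert sum of `n` copies of `K` is isometric to the space of fixed vectors; the `T i` are
its summands. -/
theorem exists_isometric_fixed_family [SeparableSpace H]
    (hinf : ¬ FiniteDimensional ℂ (fixedVectors α)) {n : ℕ} (hn : 0 < n)
    (K : Type*) [NormedAddCommGroup K] [InnerProductSpace ℂ K] [CompleteSpace K]
    [SeparableSpace K] (hK : ¬ FiniteDimensional ℂ K) :
    ∃ T : Fin n → K →L[ℂ] H,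
      (∀ i l a b, inner ℂ (T i a) (T l b) = if i = l then inner ℂ a b else 0) ∧
      (∀ i a, T i a ∈ fixedVectors α) := by
  have : SeparableSpace (lp (fun _ : Fin n => K) 2) := separableSpace_lp
  have hK' : ¬ FiniteDimensional ℂ (lp (fun _ : Fin n => K) 2) := fun h => by
    refine hK (FiniteDimensional.of_injective
      (lp.lsingle (𝕜 := ℂ) (E := fun _ : Fin n => K) 2 ⟨0, hn⟩) ?_)
    exact (lp.isometry_single (E := fun _ : Fin n => K) (p := 2) ⟨0, hn⟩).injective
  obtain ⟨A⟩ := exists_linearIsometryEquiv hK' hinf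
  refine ⟨fun i => (fixedVectors α).subtypeL.comp ((A.toContinuousLinearEquiv :
    lp (fun _ : Fin n => K) 2 →L[ℂ] fixedVectors α).comp
      (lp.singleContinuousLinearMap ℂ (fun _ : Fin n => K) 2 i)), fun i l a b => ?_,
    fun i a => Subtype.prop _⟩
  change inner ℂ ((A (lp.single 2 i a) : fixedVectors α) : H) (A (lp.single 2 l b)) = _
  rw [← Submodule.coe_inner, A.inner_map_map, lp.inner_single_left]
  split_ifs with h
  · rw [h, lp.single_apply_self]
  · rw [lp.single_apply_ne _ _ _ h, inner_zero_right]

end FixedVectors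

end StableHom

/-! ### Operators acting simultaneously on orthogonal copies of a Hilbert space -/

section Amplification

variable {K H : Type*} [NormedAddCommGroup K] [InnerProductSpace ℂ K] [CompleteSpace K]
  [NormedAddCommGroup H] [InnerProductSpace ℂ H] [CompleteSpace H] {n : ℕ}

/-- For isometries `B i : K → H` with pairwise orthogonal ranges, the operator that acts as `T` on
the range of each `B i` and as the identity on the complement of these ranges. -/
def amplification (B : Fin n → K →L[ℂ] H) (T : K →L[ℂ] K) : H →L[ℂ] H :=
  1 + ∑ i, (B i).comp ((T - 1).comp (ContinuousLinearMap.adjoint (B i)))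

variable {B : Fin n → K →L[ℂ] H}

theorem amplification_apply (T : K →L[ℂ] K) (h : H) : amplification B T h =
    h + ∑ i, B i (T (ContinuousLinearMap.adjoint (B i) h) - ContinuousLinearMap.adjoint (B i) h) := by
  simp [amplification]

theorem amplification_one : amplification B 1 = 1 := by
  simp [amplification]

theorem star_amplification (T : K →L[ℂ] K) :
    star (amplification B T) = amplification B (star T) := by
  simp only [amplification, ContinuousLinearMap.star_eq_adjoint, map_add, map_sum,
    ContinuousLinearMap.adjoint_comp, ContinuousLinearMap.adjoint_adjoint, map_sub,
    ContinuousLinearMap.comp_assoc]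
  rw [← ContinuousLinearMap.star_eq_adjoint (1 : H →L[ℂ] H),
    ← ContinuousLinearMap.star_eq_adjoint (1 : K →L[ℂ] K), star_one, star_one]

theorem adjoint_apply_apply
    (hB : ∀ i l a b, inner ℂ (B i a) (B l b) = if i = l then inner ℂ a b else 0) (i l : Fin n)
    (a : K) : ContinuousLinearMap.adjoint (B l) (B i a) = if l = i then a else 0 := by
  refine ext_inner_left ℂ fun b => ?_
  rw [ContinuousLinearMap.adjoint_inner_right, hB]
  split_ifs <;> simp

theorem amplification_apply_apply
    (hB : ∀ i l a b, inner ℂ (B i a) (B l b) = if i = l then inner ℂ a b else 0)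
    (T : K →L[ℂ] K) (i : Fin n) (a : K) : amplification B T (B i a) = B i (T a) := by
  rw [amplification_apply, Finset.sum_eq_single i]
  · simp [adjoint_apply_apply hB]
  · intro l _ hl
    simp [adjoint_apply_apply hB, hl]
  · simp

theorem amplification_apply_of_adjoint_eq_zero (T : K →L[ℂ] K) {h : H}
    (hh : ∀ i, ContinuousLinearMap.adjoint (B i) h = 0) : amplification B T h = h := by
  simp [amplification_apply, hh]

theorem adjoint_sub_sum_eq_zero
    (hB : ∀ i l a b, inner ℂ (B i a) (B l b) = if i = l then inner ℂ a b else 0) (h : H)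
    (l : Fin n) : ContinuousLinearMap.adjoint (B l)
      (h - ∑ i, B i (ContinuousLinearMap.adjoint (B i) h)) = 0 := by
  simp [map_sub, map_sum, adjoint_apply_apply hB]

theorem amplification_mul
    (hB : ∀ i l a b, inner ℂ (B i a) (B l b) = if i = l then inner ℂ a b else 0)
    (S T : K →L[ℂ] K) : amplification B S * amplification B T = amplification B (S * T) := by
  ext h
  have hdec : h = (h - ∑ i, B i (ContinuousLinearMap.adjoint (B i) h)) +
      ∑ i, B i (ContinuousLinearMap.adjoint (B i) h) := by abel
  rw [hdec, mul_apply_eq_comp]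
  simp only [map_add, map_sum, amplification_apply_apply hB,
    amplification_apply_of_adjoint_eq_zero _ (adjoint_sub_sum_eq_zero hB h),
    mul_apply_eq_comp]

theorem amplification_mem_unitary
    (hB : ∀ i l a b, inner ℂ (B i a) (B l b) = if i = l then inner ℂ a b else 0)
    {U : K →L[ℂ] K} (hU : U ∈ unitary (K →L[ℂ] K)) :
    amplification B U ∈ unitary (H →L[ℂ] H) := by
  rw [Unitary.mem_iff] at hU ⊢
  rw [star_amplification, amplification_mul hB, amplification_mul hB, hU.1, hU.2,
    amplification_one]
  exact ⟨rfl, rfl⟩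

end Amplification

/-! ### Unitaries moving one subspace to another -/

section Unitary

variable {K : Type*} [NormedAddCommGroup K] [InnerProductSpace ℂ K] [CompleteSpace K]
  [SeparableSpace K]

theorem exists_unitary_starProjection {S S' : Submodule ℂ K} [CompleteSpace S] [CompleteSpace S']
    (hS : ¬ FiniteDimensional ℂ S) (hS' : ¬ FiniteDimensional ℂ S')
    (hSo : ¬ FiniteDimensional ℂ Sᗮ) (hSo' : ¬ FiniteDimensional ℂ S'ᗮ) :
    ∃ U ∈ unitary (K →L[ℂ] K), ∀ a, U (S.starProjection a) = S'.starProjection (U a) := by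
  obtain ⟨A⟩ := exists_linearIsometryEquiv hS hS'
  obtain ⟨A'⟩ := exists_linearIsometryEquiv hSo hSo'
  let U : K →ₗ[ℂ] K := S'.subtype ∘ₗ (A.toLinearEquiv : S →ₗ[ℂ] S') ∘ₗ
      (S.orthogonalProjectionOnto : K →ₗ[ℂ] S) +
    S'ᗮ.subtype ∘ₗ (A'.toLinearEquiv : Sᗮ →ₗ[ℂ] S'ᗮ) ∘ₗ
      (Sᗮ.orthogonalProjectionOnto : K →ₗ[ℂ] Sᗮ)
  have hU : ∀ a, U a = (A (S.orthogonalProjectionOnto a) : K) +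
    (A' (Sᗮ.orthogonalProjectionOnto a) : K) := fun a => rfl
  have hadd : ∀ (b : S) (c : Sᗮ), U (b + c) = A b + A' c := by
    intro b c
    have h1 : S.orthogonalProjectionOnto ((b : K) + c) = b := by
      rw [map_add, Submodule.orthogonalProjectionOnto_mem_subspace_eq_self,
        Submodule.orthogonalProjectionOnto_apply_of_mem_orthogonal c.2, add_zero]
    have h2 : Sᗮ.orthogonalProjectionOnto ((b : K) + c) = c := by
      rw [map_add, Submodule.orthogonalProjectionOnto_mem_subspace_eq_self,
        Submodule.orthogonalProjectionOnto_apply_of_mem_orthogonal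
          (S.le_orthogonal_orthogonal b.2), zero_add]
    rw [hU, h1, h2]
  have hdec : ∀ a, ∃ (b : S) (c : Sᗮ), a = (b : K) + c := fun a =>
    ⟨S.orthogonalProjectionOnto a, Sᗮ.orthogonalProjectionOnto a,
      (Submodule.starProjection_add_starProjection_orthogonal (K := S) a).symm⟩
  have hnorm : ∀ a, ‖U a‖ = ‖a‖ := by
    intro a
    obtain ⟨b, c, rfl⟩ := hdec a
    refine (pow_left_inj₀ (norm_nonneg _) (norm_nonneg _) two_ne_zero).1 ?_
    have h1 : ‖(A b : K)‖ = ‖(b : K)‖ := A.norm_map b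
    have h2 : ‖(A' c : K)‖ = ‖(c : K)‖ := A'.norm_map c
    rw [hadd, @norm_add_sq ℂ, @norm_add_sq ℂ, (Submodule.mem_orthogonal _ _).1 c.2 b b.2,
      (Submodule.mem_orthogonal _ _).1 (A' c).2 (A b) (A b).2, h1, h2]
  have hsurj : Function.Surjective U := by
    intro b
    refine ⟨A.symm (S'.orthogonalProjectionOnto b) + A'.symm (S'ᗮ.orthogonalProjectionOnto b), ?_⟩
    rw [hadd]
    simp
  let E : K ≃ₗᵢ[ℂ] K := LinearIsometryEquiv.ofSurjective ⟨U, hnorm⟩ hsurj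
  refine ⟨_, (Unitary.linearIsometryEquiv.symm E).2, fun a => ?_⟩
  change U (S.starProjection a) = S'.starProjection (U a)
  obtain ⟨b, c, rfl⟩ := hdec a
  have h1 : S.starProjection (b + c : K) = (b : K) + ((0 : Sᗮ) : K) := by
    rw [map_add, Submodule.starProjection_eq_self_iff.2 b.2,
      (Submodule.starProjection_apply_eq_zero_iff S).2 c.2]
    rfl
  rw [h1, hadd, hadd, map_zero, map_add, Submodule.starProjection_eq_self_iff.2 (A b).2,
    (Submodule.starProjection_apply_eq_zero_iff S').2 (A' c).2]
  rfl

end Unitary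

/-! ### Conjugates of `α` by amplified unitaries -/

namespace StableHom

section Conjugation

variable {G H K : Type*} [Group G] [TopologicalSpace G] [NormedAddCommGroup H]
  [InnerProductSpace ℂ H] [CompleteSpace H] [NormedAddCommGroup K] [InnerProductSpace ℂ K]
  [CompleteSpace K]

/-- The element of `U(H)` given by a unitary operator. -/
def UH.ofUnitary (T : H →L[ℂ] H) (hT : T ∈ unitary (H →L[ℂ] H)) : UH H :=
  (⟨T, hT⟩ : unitary (H →L[ℂ] H))

theorem UH.op_ofUnitary (T : H →L[ℂ] H) (hT : T ∈ unitary (H →L[ℂ] H)) :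
    (UH.ofUnitary T hT).op = T := rfl

theorem UH.op_inv_ofUnitary (T : H →L[ℂ] H) (hT : T ∈ unitary (H →L[ℂ] H)) :
    (UH.ofUnitary T hT)⁻¹.op = star T := rfl

/-- The right side involves the projection to `S'` but not `U`: an arbitrary choice of unitaries
thus still gives a continuous family of conjugates. -/
theorem conj_amplification_apply {α : G →ₜ* UH H} {n : ℕ} {B : Fin n → K →L[ℂ] H}
    (hB : ∀ i l a b, inner ℂ (B i a) (B l b) = if i = l then inner ℂ a b else 0)
    {S S' : Submodule ℂ K} [S.HasOrthogonalProjection] [S'.HasOrthogonalProjection]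
    {ρ : G → Fin n → Fin n → ℂ}
    (hα : ∀ g i a, (α g).op (B i a) =
      ∑ l, ρ g l i • B l (S.starProjection a) + B i (a - S.starProjection a))
    {U : K →L[ℂ] K} (hU : U ∈ unitary (K →L[ℂ] K))
    (hUS : ∀ a, U (S.starProjection a) = S'.starProjection (U a)) (g : G) (h : H) :
    (conj (UH.ofUnitary _ (amplification_mem_unitary hB hU)) α g).op h =
      ∑ i, (∑ l, ρ g l i • B l (S'.starProjection (ContinuousLinearMap.adjoint (B i) h)) +
        B i (ContinuousLinearMap.adjoint (B i) h -
          S'.starProjection (ContinuousLinearMap.adjoint (B i) h))) +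
      (α g).op (h - ∑ i, B i (ContinuousLinearMap.adjoint (B i) h)) := by
  have hUU : ∀ a, U (star U a) = a := fun a =>
    congrArg (fun T : K →L[ℂ] K => T a) (Unitary.mem_iff.1 hU).2
  set b : Fin n → K := fun i => ContinuousLinearMap.adjoint (B i) h with hb
  set r : H := h - ∑ i, B i (b i) with hr
  have hr0 : ∀ i, ContinuousLinearMap.adjoint (B i) r = 0 := adjoint_sub_sum_eq_zero hB h
  have hBr : ∀ i a, inner ℂ (B i a) r = 0 := fun i a => by
    rw [← ContinuousLinearMap.adjoint_inner_right, hr0, inner_zero_right]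
  -- The span of the ranges of the `B i` is stable under `α g⁻¹`, so its orthogonal complement is
  -- stable under `α g`.
  have hαr : ∀ i, ContinuousLinearMap.adjoint (B i) ((α g).op r) = 0 := by
    intro i
    refine ext_inner_left ℂ fun a => ?_
    rw [ContinuousLinearMap.adjoint_inner_right, inner_zero_right, ← inv_inv (α g),
      ← UH.inner_op_left, ← map_inv, hα, inner_add_left, sum_inner, hBr, add_zero]
    exact Finset.sum_eq_zero fun l _ => by rw [inner_smul_left, hBr, mul_zero]
  have hdec : h = ∑ i, B i (b i) + r := by rw [hr]; abel
  rw [conj_apply, UH.op_mul, UH.op_mul, UH.op_inv_ofUnitary, UH.op_ofUnitary,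
    star_amplification, mul_apply_eq_comp, mul_apply_eq_comp]
  conv_lhs => rw [hdec]
  simp only [map_add, map_sum, amplification_apply_apply hB,
    amplification_apply_of_adjoint_eq_zero _ hr0, hα,
    amplification_apply_of_adjoint_eq_zero _ hαr, map_smul, map_sub, hUS, hUU]
  rfl

theorem continuous_conj_amplification {X : Type*} [TopologicalSpace X] {α : G →ₜ* UH H} {n : ℕ}
    {B : Fin n → K →L[ℂ] H}
    (hB : ∀ i l a b, inner ℂ (B i a) (B l b) = if i = l then inner ℂ a b else 0)
    {S : Submodule ℂ K} [S.HasOrthogonalProjection]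
    {S' : X → Submodule ℂ K} [∀ x, (S' x).HasOrthogonalProjection]
    (hS' : ∀ a, Continuous fun x => (S' x).starProjection a)
    {ρ : G → Fin n → Fin n → ℂ} (hρ : ∀ l i, Continuous fun g => ρ g l i)
    (hα : ∀ g i a, (α g).op (B i a) =
      ∑ l, ρ g l i • B l (S.starProjection a) + B i (a - S.starProjection a))
    {U : X → K →L[ℂ] K} (hU : ∀ x, U x ∈ unitary (K →L[ℂ] K))
    (hUS : ∀ x a, U x (S.starProjection a) = (S' x).starProjection (U x a)) :
    Continuous fun x => conj (UH.ofUnitary _ (amplification_mem_unitary hB (hU x))) α := by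
  refine ContinuousMonoidHom.continuous_of_continuous_uncurry _ (UH.continuous_iff.2 fun h => ?_)
  have hc : Continuous fun p : X × G =>
      ∑ i, (∑ l, ρ p.2 l i • B l ((S' p.1).starProjection (ContinuousLinearMap.adjoint (B i) h)) +
        B i (ContinuousLinearMap.adjoint (B i) h -
          (S' p.1).starProjection (ContinuousLinearMap.adjoint (B i) h))) +
      (α p.2).op (h - ∑ i, B i (ContinuousLinearMap.adjoint (B i) h)) := by
    have hP : ∀ i, Continuous fun p : X × G =>
        (S' p.1).starProjection (ContinuousLinearMap.adjoint (B i) h) := fun i =>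
      (hS' _).comp continuous_fst
    refine Continuous.add (continuous_finsetSum _ fun i _ => Continuous.add
      (continuous_finsetSum _ fun l _ => ?_) ?_) ?_
    · exact ((hρ l i).comp continuous_snd).smul ((B l).continuous.comp (hP i))
    · exact (B i).continuous.comp (continuous_const.sub (hP i))
    · exact (UH.continuous_iff.1 α.continuous_toFun _).comp continuous_snd
  refine hc.congr fun p => ?_
  exact (conj_amplification_apply hB hα (hU p.1) (hUS p.1) p.2 h).symm

end Conjugation

/-! ### From a section of the conjugation map to a section of the field -/

section NoSection

variable {G H K : Type*} [Group G] [TopologicalSpace G] [NormedAddCommGroup H]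
  [InnerProductSpace ℂ H] [CompleteSpace H] [SeparableSpace H] [NormedAddCommGroup K]
  [InnerProductSpace ℂ K] [CompleteSpace K] [SeparableSpace K]

/-- On `S` the `B i` parametrise the intertwining maps from `V`, on `Sᗮ` they take values in the
fixed vectors; the two families are orthogonal because `V` is nontrivial. -/
theorem exists_adapted_family {α : G →ₜ* UH H} {V : IrrepObj G} (hV : V.cls ≠ trivialIrrep G)
    {j₀ : V.rep.IntertwiningMap (repOf α)} (hj₀ : j₀ ≠ 0) {n : ℕ} {v : Fin n → Fin V.dim → ℂ}
    (hv : IsFrame j₀ v) (hinf : ¬ FiniteDimensional ℂ (isotypical α V))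
    (hfix : ¬ FiniteDimensional ℂ (fixedVectors α)) {S : Submodule ℂ K} [CompleteSpace S]
    (hS : ¬ FiniteDimensional ℂ S) (hSo : ¬ FiniteDimensional ℂ Sᗮ) :
    ∃ B : Fin n → K →L[ℂ] H,
      (∀ i l a b, inner ℂ (B i a) (B l b) = if i = l then inner ℂ a b else 0) ∧
      (∀ g i a, (α g).op (B i a) =
        ∑ l, inner ℂ (j₀ (v l)) ((α g).op (j₀ (v i))) • B l (S.starProjection a) +
          B i (a - S.starProjection a)) ∧
      (∀ j : V.rep.IntertwiningMap (repOf α), ∃ a ∈ S, ∀ i, j (v i) = B i a) := by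
  obtain ⟨T, hT, hT1, hT2⟩ := hv.exists_isometric_family hj₀ hinf S hS
  obtain ⟨T', hT', hT'1⟩ := exists_isometric_fixed_family hfix hv.pos Sᗮ hSo
  have horth : ∀ i l a b, inner ℂ (T' i a) (T l b) = 0 := by
    intro i l a b
    obtain ⟨j, hj⟩ := hT1 b
    rw [hj]
    exact inner_intertwiningMap_fixedVectors hV j _ (hT'1 i a)
  have horth' : ∀ i l a b, inner ℂ (T l b) (T' i a) = 0 := fun i l a b =>
    inner_eq_zero_symm.1 (horth i l a b)
  let B : Fin n → K →L[ℂ] H := fun i =>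
    (T i).comp S.orthogonalProjectionOnto + (T' i).comp Sᗮ.orthogonalProjectionOnto
  have hBdef : ∀ i a, B i a =
      T i (S.orthogonalProjectionOnto a) + T' i (Sᗮ.orthogonalProjectionOnto a) := fun _ _ => rfl
  have hBS : ∀ i (a : S), B i a = T i a := by
    intro i a
    rw [hBdef, Submodule.orthogonalProjectionOnto_mem_subspace_eq_self,
      Submodule.orthogonalProjectionOnto_apply_of_mem_orthogonal
        (S.le_orthogonal_orthogonal a.2), map_zero, add_zero]
  have hBo : ∀ i (a : Sᗮ), B i a = T' i a := by
    intro i a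
    rw [hBdef, Submodule.orthogonalProjectionOnto_mem_subspace_eq_self,
      Submodule.orthogonalProjectionOnto_apply_of_mem_orthogonal a.2, map_zero, zero_add]
  refine ⟨B, fun i l a b => ?_, fun g i a => ?_, fun j => ?_⟩
  · rw [hBdef, hBdef, inner_add_left, inner_add_right, inner_add_right, hT, hT', horth, horth']
    split_ifs
    · have ha := Submodule.starProjection_add_starProjection_orthogonal (K := S) a
      have hb := Submodule.starProjection_add_starProjection_orthogonal (K := S) b
      conv_rhs => rw [← ha, ← hb]
      rw [inner_add_left, inner_add_right, inner_add_right,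
        (Submodule.mem_orthogonal _ _).1 (Submodule.starProjection_apply_mem Sᗮ b) _
          (Submodule.starProjection_apply_mem S a),
        (Submodule.mem_orthogonal' _ _).1 (Submodule.starProjection_apply_mem Sᗮ a) _
          (Submodule.starProjection_apply_mem S b)]
      rfl
    · simp
  · have h1 : B i a = B i (S.orthogonalProjectionOnto a : K) +
        B i (Sᗮ.orthogonalProjectionOnto a : K) := by
      rw [hBS, hBo, hBdef]
    have h2 : a - S.starProjection a = (Sᗮ.orthogonalProjectionOnto a : K) := by
      rw [sub_eq_iff_eq_add']
      exact (Submodule.starProjection_add_starProjection_orthogonal (K := S) a).symm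
    have h3 : S.starProjection a = (S.orthogonalProjectionOnto a : K) := rfl
    rw [h1, map_add, h2, h3, hBo, hT'1 i _ g]
    congr 1
    obtain ⟨j, hj⟩ := hT1 (S.orthogonalProjectionOnto a)
    simp only [hBS, hj]
    rw [← intertwiningMap_apply, ← hv.sum_eq (V.rep g (v i)), map_sum]
    refine Finset.sum_congr rfl fun l _ => ?_
    rw [map_smul, intertwiningMap_apply]
  · obtain ⟨a, ha⟩ := hT2 j
    exact ⟨a, a.2, fun i => by rw [ha, hBS]⟩

theorem exists_section_of_rightInverse {C : Set (Irrep G)} {α : homSt G H C}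
    {σ : homSt G H C → UH H} (hσ : Continuous σ) (hσα : ∀ β, conjMap α (σ β) = β)
    {V : IrrepObj G} (hVC : V.cls ∈ C) (hV : V.cls ≠ trivialIrrep G) (hC : trivialIrrep G ∈ C)
    {X : Type*} [TopologicalSpace X] [Nonempty X] {S : X → Submodule ℂ K} [∀ x, CompleteSpace (S x)]
    (hScont : ∀ a, Continuous fun x => (S x).starProjection a)
    (hS : ∀ x, ¬ FiniteDimensional ℂ (S x)) (hSo : ∀ x, ¬ FiniteDimensional ℂ (S x)ᗮ) :
    ∃ s : X → K, Continuous s ∧ ∀ x, s x ∈ S x ∧ s x ≠ 0 := by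
  have hinf : ¬ FiniteDimensional ℂ (isotypical α.1 V) := (α.2 V).1 hVC
  have hfix : ¬ FiniteDimensional ℂ (fixedVectors α.1) := fun h =>
    (α.2 (trivialObj G)).1 hC (Submodule.finiteDimensional_of_le isotypical_trivialObj_le)
  obtain ⟨j₀, hj₀⟩ : ∃ j₀ : V.rep.IntertwiningMap (repOf α.1), j₀ ≠ 0 := by
    by_contra! h
    refine hinf ?_
    have : isotypical α.1 V = ⊥ := by
      refine iSup_eq_bot.2 fun f => ?_
      rw [h f]
      exact LinearMap.range_zero
    rw [this]
    infer_instance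
  obtain ⟨n, v, hv⟩ := exists_isFrame hj₀
  obtain ⟨x₀⟩ := ‹Nonempty X›
  obtain ⟨B, hB, hBα, hBj⟩ := exists_adapted_family hV hj₀ hv hinf hfix (hS x₀) (hSo x₀)
  -- No continuity of `U` in `x` is available or required.
  choose U hU hUS using fun x => exists_unitary_starProjection (hS x₀) (hS x) (hSo x₀) (hSo x)
  let F : X → UH H := fun x => UH.ofUnitary _ (amplification_mem_unitary hB (hU x))
  have hβ : Continuous fun x => conjMap α (F x) :=
    (continuous_conj_amplification hB hScont
      (ρ := fun g l i => inner ℂ (j₀ (v l)) ((α.1 g).op (j₀ (v i))))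
      (fun l i => continuous_const.inner (UH.continuous_iff.1 α.1.continuous_toFun _))
      hBα hU hUS).subtype_mk _
  let i₀ : Fin n := ⟨0, hv.pos⟩
  -- Both `s` and `F x` conjugate `α` to the same homomorphism, so `(F x)⁻¹ * s` commutes with `α`
  -- and its composite with `j₀` is again an intertwining map, with a parameter in `S x₀`. Applying
  -- `F x` moves this parameter into `S x` by `U x`.
  have key : ∀ x, ∃ a ∈ S x, (σ (conjMap α (F x))).op (j₀ (v i₀)) = B i₀ a := by
    intro x
    set s := σ (conjMap α (F x)) with hs
    have hcomm : ∀ g, (F x)⁻¹ * s * α.1 g = α.1 g * ((F x)⁻¹ * s) := by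
      intro g
      have h1 : conj s α.1 = conj (F x) α.1 := congrArg Subtype.val (hσα (conjMap α (F x)))
      have h2 : s * α.1 g * s⁻¹ = F x * α.1 g * (F x)⁻¹ := by
        rw [← conj_apply, ← conj_apply, h1]
      rw [mul_inv_eq_iff_eq_mul] at h2
      rw [mul_assoc, h2]
      group
    let k : V.rep.IntertwiningMap (repOf α.1) :=
      { toLinearMap := (((F x)⁻¹ * s).op : H →ₗ[ℂ] H) ∘ₗ j₀.toLinearMap
        isIntertwining' := fun g => LinearMap.ext fun w => by
          have h := congrArg (fun f : UH H => f.op (j₀ w)) (hcomm g)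
          change ((F x)⁻¹ * s).op (j₀ (V.rep g w)) = (α.1 g).op (((F x)⁻¹ * s).op (j₀ w))
          rw [intertwiningMap_apply]
          exact h }
    obtain ⟨a, ha, hka⟩ := hBj k
    have hk : k (v i₀) = (F x)⁻¹.op (s.op (j₀ (v i₀))) := rfl
    refine ⟨U x a, ?_, ?_⟩
    · rw [← Submodule.starProjection_eq_self_iff, ← hUS, Submodule.starProjection_eq_self_iff.2 ha]
    · have h1 := congrArg (F x).op (hk.symm.trans (hka i₀))
      rw [UH.op_op_inv] at h1
      rw [h1]
      exact amplification_apply_apply hB (U x) i₀ a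
  refine ⟨fun x => ContinuousLinearMap.adjoint (B i₀) ((σ (conjMap α (F x))).op (j₀ (v i₀))),
    ?_, fun x => ?_⟩
  · exact (ContinuousLinearMap.continuous _).comp (UH.continuous_iff.1 (hσ.comp hβ) _)
  · obtain ⟨a, ha, h⟩ := key x
    beta_reduce
    rw [h, adjoint_apply_apply hB, if_pos rfl]
    refine ⟨ha, fun h0 => ?_⟩
    rw [h0, map_zero] at h
    have h1 := (σ (conjMap α (F x))).inner_op_op (j₀ (v i₀)) (j₀ (v i₀))
    rw [h, inner_zero_left, hv.inner_eq, if_pos rfl] at h1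
    exact zero_ne_one h1

end NoSection

end StableHom

end

theorem mainTheorem1
    {E : Type*} [NormedAddCommGroup E] [NormedSpace ℝ E] [FiniteDimensional ℝ E]
    {G : Type*} [Group G] [TopologicalSpace G] [ChartedSpace E G] [LieGroup 𝓘(ℝ, E) ∞ G]
    [CompactSpace G]
    {H : Type*} [NormedAddCommGroup H] [InnerProductSpace ℂ H] [CompleteSpace H]
    [TopologicalSpace.SeparableSpace H] (hH : ¬ FiniteDimensional ℂ H)
    (C : Set (StableHom.Irrep G)) (hC : StableHom.trivialIrrep G ∈ C)
    (hC' : ∃ V ∈ C, V ≠ StableHom.trivialIrrep G)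
    (α : StableHom.homSt G H C) :
    ¬ ∃ σ : StableHom.homSt G H C → StableHom.UH H,
      Continuous σ ∧ ∀ β, StableHom.conjMap α (σ β) = β := by
  rintro ⟨σ, hσ, hσα⟩
  obtain ⟨V', hVC, hV⟩ := hC'
  obtain ⟨V, rfl⟩ := Quotient.exists_rep V'
  -- Dimension 2 is the least that keeps every block nonzero up to the boundary of the ball.
  have hF : 1 < Module.finrank ℂ (EuclideanSpace ℂ (Fin 2)) := by simp
  obtain ⟨s, hs, hsS⟩ := StableHom.exists_section_of_rightInverse hσ hσα hVC hV hC
    (X := ℕ → Metric.closedBall (0 : EuclideanSpace ℂ (Fin 2)) 1) (S := productSubspace)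
    continuous_starProjection_productSubspace (not_finiteDimensional_productSubspace hF)
    not_finiteDimensional_productSubspace_orthogonal
  obtain ⟨x, hx⟩ := exists_eq_zero_of_mem_productSubspace hs fun x => (hsS x).1
  exact (hsS x).2 hx
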